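/- Let $\|\cdot\|$ be any norm on $\mathbb{R}^K$ with dual norm $\|\cdot\|_*$. Write $L^m=\{u\in\mathbb{R}^m: u_m\ge (u_1^2+\dots+u_{m-1}^2)^{1/2}\}$, $m\ge 1$, for the second-order cones. A set $S\subseteq\mathbb{R}^n$ is *second-order cone representable* if there are finitely many matrices $A_j$ and vectors $b_j$ with $y\in S\iff \exists v:\ A_j(y,v)-b_j\in L^{m_j}$ for all $j$. *Decisions.* $x=(x_d,x_c)$ ranges over $\mathcal{X}=\overline{\mathcal{X}}\cap(\{0,1\}^{n_1}\times\mathbb{R}^{n_2})$, where $\overline{\mathcal{X}}$ is second-order cone representable. *Costs.* The support $\Xi\subseteq\mathbb{R}^K$ of the uncertainty is second-order cone representable, and the cost $c(x,y)$, for $x\in\mathcal{X}$, $y\in\Xi$, has one of the following two forms. (a) Single-stage: $\Xi\subseteq\mathbb{R}^K_{\ge 0}$ and $c(x,y)=\sum_{k=1}^K c_k(x)y_k$, where each $c_k$ is a real-valued function on a domain $D_k\supseteq\mathcal{X}$ whose epigraph $\{(x,u): x\in D_k,\ c_k(x)\le u\}$ is second-order cone representable. (b) Two-stage: $c(x,y)=\min\{q^{T}\gamma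 : \gamma\ge 0,\ T(y)x+W\gamma=h(y)\}$ with $T(y)=T_0+\sum_k y_kT_k$ and $h(y)=h_0+\sum_k y_kh_k$, where for all $x\in\mathcal{X}$, $y\in\Xi$ this linear program is feasible and has a finite optimal value. *Ambiguity set.* Let $y_1,\dots,y_N\in\Xi$ be data, let $\omega_n(z)\ge 0$ with $\sum_{n=1}^N\omega_n(z)=1$ be weights depending on the covariate $z$, let $\widehat{\mathbb{P}}(z)=\sum_n\omega_n(z)\delta_{y_n}$, and let $\epsilon_\theta(z)\ge 0$ be a radius with parameter $\theta$. Let $$\mathscr{U}_\theta(z)=\{\mathbb{P}: \mathbb{P}(\Xi)=1,\ d_W(\widehat{\mathbb{P}}(z),\mathbb{P})\le\epsilon_\theta(z)\},\qquad d_W(\mathbb{P},\mathbb{Q})=\inf_{\pi}\int\|y-y'\|\,d\pi(y,y'),$$ with $\mathbb{P}$ ranging over the Borel probability measures on $\mathbb{R}^K$ and $\pi$ over the couplings of $\mathbb{P}$ and $\mathbb{Q}$ (type-1 Wasserstein distance). The contextual Wasserstein DRO problem is $$\min_{x\in\mathcal{X}} f(x),\qquad f(x)=\sup_{\mathbb{P}\in\mathscr{U}_\theta(z)}\mathbb{E}_{y\sim\mathbb{P}}[c(x,y)].\tag{WDRO}$$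 A problem $\min_{x\in X}f(x)$ is a *linear cone program* if there are a linear objective $\ell(x,w)$ and finitely many constraints $A_j(x,w)-b_j\in\mathcal{C}_j$ in $x$ and finitely many real auxiliary variables $w$, with each $\mathcal{C}_j$ a second-order cone or the dual norm cone $\{(\gamma,t)\in\mathbb{R}^K\times\mathbb{R}:\|\gamma\|_*\le t\}$, such that $x\in X$ if and only if some $w$ makes $(x,w)$ feasible, and, for every $x\in X$, $f(x)$ is the minimum (attained) of $\ell(x,w)$ over all such $w$. It is a *mixed-integer linear cone program* if the same holds with the additional constraint $x_d\in\{0,1\}^{n_1}$ on $x$. Then, for all $\theta$ and $z$, $c(x,\cdot)$ is $\mathbb{P}$-integrable for all $x\in\mathcal{X}$ and $\mathbb{P}\in\mathscr{U}_\theta(z)$, and (i) (WDRO) is a mixed-integer linear cone program; (ii) for every fixed $x_d\in\{0,1\}^{n_1}$, the problem $\min\{f(x_d,x_c): x_c\in\mathbb{R}^{n_2},\ (x_d,x_c)\in\mathcal{X}\}$ is a linear cone program. -/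

import Mathlib

open MeasureTheory

/-- The second-order cone `L^{m+1} = {y ∈ ℝ^{m+1} : y_{m+1} ≥ √(y₁² + ⋯ + y_m²)}`.
For `m = 0` it is the half-line of non-negative reals. -/
def secondOrderCone (m : ℕ) : Set (Fin (m + 1) → ℝ) :=
  {y | Real.sqrt (∑ i : Fin m, y i.castSucc ^ 2) ≤ y (Fin.last m)}

/-- The cone `{(γ, t) : ‖γ‖_* ≤ t}` of the norm dual to `N`, that is,
`‖γ‖_* = sup {γᵀ y : N y ≤ 1}`. -/
def dualNormCone {K : ℕ} (N : Seminorm ℝ (Fin K → ℝ)) : Set (Fin (K + 1) → ℝ) :=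
  {p | ∀ y : Fin K → ℝ, N y ≤ 1 → (fun k : Fin K => p k.castSucc) ⬝ᵥ y ≤ p (Fin.last K)}

/-- `S` is second-order cone representable: it is the projection of a set described by finitely
many second-order cone inequalities `A_j (y, v) - b_j ∈ L^{m_j + 1}`. -/
def IsSOCRepresentable {ι : Type} [Fintype ι] (S : Set (ι → ℝ)) : Prop :=
  ∃ (p J : ℕ) (m : Fin J → ℕ) (A : ∀ j : Fin J, Matrix (Fin (m j + 1)) (ι ⊕ Fin p) ℝ)
    (b : ∀ j : Fin J, Fin (m j + 1) → ℝ),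
    ∀ y : ι → ℝ, y ∈ S ↔
      ∃ v : Fin p → ℝ, ∀ j : Fin J, (A j).mulVec (Sum.elim y v) - b j ∈ secondOrderCone (m j)

/-- The data of a linear cone program in the decision `x ∈ ℝ^ι` and auxiliary variables
`w ∈ ℝ^numAux`: minimize `objᵀ (x, w)` subject to `A_j (x, w) - b_j ∈ cone_j` for finitely many
`j`, where all cones belong to the family `𝒦`. -/
structure LinearConeProgram (𝒦 : ∀ m : ℕ, Set (Fin m → ℝ) → Prop) (ι : Type) [Fintype ι] where
  numAux : ℕ
  numCon : ℕ
  dim : Fin numCon → ℕ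
  cone : ∀ j : Fin numCon, Set (Fin (dim j) → ℝ)
  cone_mem : ∀ j : Fin numCon, 𝒦 (dim j) (cone j)
  A : ∀ j : Fin numCon, Matrix (Fin (dim j)) (ι ⊕ Fin numAux) ℝ
  b : ∀ j : Fin numCon, Fin (dim j) → ℝ
  obj : ι ⊕ Fin numAux → ℝ

namespace LinearConeProgram

/-- `(x, w)` satisfies all cone constraints. -/
def Feasible {𝒦 : ∀ m : ℕ, Set (Fin m → ℝ) → Prop} {ι : Type} [Fintype ι]
    (Q : LinearConeProgram 𝒦 ι) (x : ι → ℝ) (w : Fin Q.numAux → ℝ) : Prop :=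
  ∀ j : Fin Q.numCon, (Q.A j).mulVec (Sum.elim x w) - Q.b j ∈ Q.cone j

/-- The linear objective at `(x, w)`. -/
def value {𝒦 : ∀ m : ℕ, Set (Fin m → ℝ) → Prop} {ι : Type} [Fintype ι]
    (Q : LinearConeProgram 𝒦 ι) (x : ι → ℝ) (w : Fin Q.numAux → ℝ) : ℝ :=
  Q.obj ⬝ᵥ Sum.elim x w

end LinearConeProgram

/-- The problem `min_{x ∈ X} f x` is a linear cone program over the cones `𝒦`: for some linear
cone program in `x` and auxiliary variables `w`, the points of `X` are exactly those that extend
to a feasible `(x, w)`, and `f x` is the minimum of the linear objective over these extensions. -/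
def IsLinearConeProgram (𝒦 : ∀ m : ℕ, Set (Fin m → ℝ) → Prop) {ι : Type} [Fintype ι]
    (X : Set (ι → ℝ)) (f : (ι → ℝ) → EReal) : Prop :=
  ∃ Q : LinearConeProgram 𝒦 ι,
    (∀ x : ι → ℝ, x ∈ X ↔ ∃ w, Q.Feasible x w) ∧
    ∀ x ∈ X, IsLeast {t : EReal | ∃ w, Q.Feasible x w ∧ t = (Q.value x w : EReal)} (f x)

/-- The problem `min_{x ∈ X} f x`, with `x = (x_d, x_c)`, is a mixed-integer linear cone program
over the cones `𝒦`: the same as a linear cone program, but with the additional constraint that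
all coordinates of `x_d` lie in `{0, 1}`. -/
def IsMixedIntegerLinearConeProgram (𝒦 : ∀ m : ℕ, Set (Fin m → ℝ) → Prop) {n₁ n₂ : ℕ}
    (X : Set (Fin n₁ ⊕ Fin n₂ → ℝ)) (f : (Fin n₁ ⊕ Fin n₂ → ℝ) → EReal) : Prop :=
  ∃ Q : LinearConeProgram 𝒦 (Fin n₁ ⊕ Fin n₂),
    (∀ x : Fin n₁ ⊕ Fin n₂ → ℝ,
      x ∈ X ↔ (∀ i : Fin n₁, x (Sum.inl i) = 0 ∨ x (Sum.inl i) = 1) ∧ ∃ w, Q.Feasible x w) ∧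
    ∀ x ∈ X, IsLeast {t : EReal | ∃ w, Q.Feasible x w ∧ t = (Q.value x w : EReal)} (f x)

/-- The cones allowed in the reformulation of a Wasserstein problem whose transport cost is the
norm `N`: second-order cones and the cone of the dual norm. -/
inductive IsWassersteinCone {K : ℕ} (N : Seminorm ℝ (Fin K → ℝ)) :
    ∀ m : ℕ, Set (Fin m → ℝ) → Prop
  | secondOrder (m : ℕ) : IsWassersteinCone N (m + 1) (secondOrderCone m)
  | dualNorm : IsWassersteinCone N (K + 1) (dualNormCone N)

/-- The mixed-binary feasible region `X = Xbar ∩ ({0,1}^{n₁} × ℝ^{n₂})`. -/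
def mixedBinaryRegion {n₁ n₂ : ℕ} (Xbar : Set (Fin n₁ ⊕ Fin n₂ → ℝ)) :
    Set (Fin n₁ ⊕ Fin n₂ → ℝ) :=
  {x | x ∈ Xbar ∧ ∀ i : Fin n₁, x (Sum.inl i) = 0 ∨ x (Sum.inl i) = 1}

/-- Single-stage cost: `c(x, y) = ∑ k, c_k(x) y_k`, where each `c_k` is a real function on a
domain `D_k ⊇ X` with second-order cone representable epigraph, and the uncertainty is
non-negative. -/
def IsSingleStageCost {ι : Type} [Fintype ι] {K : ℕ} (X : Set (ι → ℝ)) (Ξ : Set (Fin K → ℝ))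
    (c : (ι → ℝ) → (Fin K → ℝ) → ℝ) : Prop :=
  (∀ y ∈ Ξ, ∀ k : Fin K, 0 ≤ y k) ∧
  ∃ (D : Fin K → Set (ι → ℝ)) (ck : Fin K → (ι → ℝ) → ℝ),
    (∀ k : Fin K, X ⊆ D k ∧
      IsSOCRepresentable {p : ι ⊕ Fin 1 → ℝ |
        (fun i => p (Sum.inl i)) ∈ D k ∧ ck k (fun i => p (Sum.inl i)) ≤ p (Sum.inr 0)}) ∧
    ∀ x ∈ X, ∀ y ∈ Ξ, c x y = ∑ k : Fin K, ck k x * y k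

/-- Two-stage cost with relatively complete recourse: for all `x ∈ X` and `y ∈ Ξ`, the linear
program `min {qᵀ γ : γ ≥ 0, T(y) x + W γ = h(y)}`, with `T` and `h` affine in `y`, is feasible and
has the optimal value `c(x, y)`. -/
def IsTwoStageCost {ι : Type} [Fintype ι] {K : ℕ} (X : Set (ι → ℝ)) (Ξ : Set (Fin K → ℝ))
    (c : (ι → ℝ) → (Fin K → ℝ) → ℝ) : Prop :=
  ∃ (r s : ℕ) (q : Fin s → ℝ) (W : Matrix (Fin r) (Fin s) ℝ)
    (T₀ : Matrix (Fin r) ι ℝ) (T : Fin K → Matrix (Fin r) ι ℝ)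
    (h₀ : Fin r → ℝ) (h : Fin K → Fin r → ℝ),
    ∀ x ∈ X, ∀ y ∈ Ξ,
      IsLeast {t : ℝ | ∃ γ : Fin s → ℝ, (∀ i, 0 ≤ γ i) ∧
        (T₀ + ∑ k : Fin K, y k • T k).mulVec x + W.mulVec γ = h₀ + ∑ k : Fin K, y k • h k ∧
        t = q ⬝ᵥ γ} (c x y)

/-- The (type-1) Wasserstein distance with transport cost `N (y - y')`: the infimum of the expected
transport cost over all couplings of `P` and `Q`. -/
noncomputable def wassersteinDist {K : ℕ} (N : Seminorm ℝ (Fin K → ℝ))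
    (P Q : Measure (Fin K → ℝ)) : ENNReal :=
  ⨅ (π : Measure ((Fin K → ℝ) × (Fin K → ℝ))) (_ : π.fst = P ∧ π.snd = Q),
    ∫⁻ p, ENNReal.ofReal (N (p.1 - p.2)) ∂π

/-- The weighted empirical distribution `∑ n, ω_n δ_{y_n}`. -/
noncomputable def weightedEmpirical {K M : ℕ} (ω : Fin M → ℝ) (y : Fin M → Fin K → ℝ) :
    Measure (Fin K → ℝ) :=
  ∑ n : Fin M, ENNReal.ofReal (ω n) • Measure.dirac (y n)

/-- The Wasserstein ambiguity set: probability distributions supported on `Ξ` at distance at most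
`ε` from the reference distribution. -/
def wassersteinAmbiguitySet {K : ℕ} (N : Seminorm ℝ (Fin K → ℝ)) (Ξ : Set (Fin K → ℝ))
    (Pref : Measure (Fin K → ℝ)) (ε : ℝ) : Set (Measure (Fin K → ℝ)) :=
  {P | IsProbabilityMeasure P ∧ P Ξ = 1 ∧ wassersteinDist N Pref P ≤ ENNReal.ofReal ε}

/-- The worst-case expectation `sup_{P ∈ 𝒰} E_P[c(x, y)]`, with values in the extended reals. -/
noncomputable def worstCaseExpectation {ι : Type} {K : ℕ} (𝒰 : Set (Measure (Fin K → ℝ)))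
    (c : (ι → ℝ) → (Fin K → ℝ) → ℝ) (x : ι → ℝ) : EReal :=
  ⨆ P ∈ 𝒰, ((∫ y, c x y ∂P : ℝ) : EReal)

/-! The inner supremum is replaced by an attained dual minimum whose constraints are conic jointly
in `x` and the dual variables.

On `Ξ` the cost `c x` is a maximum of finitely many affine functions of `y`. In the single-stage
case there is one piece, and since `y ≥ 0` its slopes may be relaxed to upper bounds of the
`c_k(x)`, so that epigraphs suffice. In the two-stage case Fourier–Motzkin elimination writes the
value of the recourse program as a maximum of finitely many linear functions of its right-hand side.
Both are recorded as `IsMaxAffineCost`.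

Such a cost is Lipschitz on `Ξ`, so all expectations are finite. The pairs (transport cost, expected
cost) of couplings form a convex set, and Lagrangian duality in the plane gives strong duality
(`exists_worstCase_eq_min`): the worst case is the least `l * ε + ∑ ω_n t_n` with `l ≥ 0` and `c v -
l * N (v - y_n) ≤ t_n` for all `v ∈ Ξ`, required only where `ω_n > 0`.

Piece by piece, this constraint is a concave inequality on `Ξ`. Fenchel duality trades the norm for
a vector `ρ` of dual norm at most `l` and leaves an affine inequality valid on `Ξ`. The delicate
point is `ConeRep.polar`: the affine inequalities valid on a second-order cone representable set
form a representable set. Slater's condition may fail for the given description, and plain conic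
duality would then lose attainment. At a suitable relative interior point each constraint value is
interior to its cone, on a boundary ray, or zero. Each cone is exchanged for an open cone together
with a subspace, Slater's condition holds on the subspace, and the conic Farkas lemma applies
exactly. -/

/-! ### Affine maps. -/

/-- A map between real vector spaces is affine: a linear map plus a constant. -/
def IsAff {E F : Type*} [AddCommGroup E] [Module ℝ E] [AddCommGroup F] [Module ℝ F]
    (φ : E → F) : Prop :=
  ∃ (L : E →ₗ[ℝ] F) (c : F), ∀ x, φ x = L x + c

namespace IsAff

variable {E F G : Type*} [AddCommGroup E] [Module ℝ E] [AddCommGroup F] [Module ℝ F]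
  [AddCommGroup G] [Module ℝ G]

theorem of_linear (L : E →ₗ[ℝ] F) : IsAff L := ⟨L, 0, by simp⟩

/-- Affinity is tested along lines, an identity that passes through every closure operation below by
rewriting. -/
theorem of_line {φ : E → F} (h : ∀ x y (s : ℝ), φ (x + s • (y - x)) = φ x + s • (φ y - φ x)) :
    IsAff φ := by
  have hsmul : ∀ (s : ℝ) (x : E), φ (s • x) - φ 0 = s • (φ x - φ 0) := by
    intro s x
    have := h 0 x s
    simp only [zero_add, sub_zero] at this
    rw [this]; abel
  refine ⟨⟨⟨fun x => φ x - φ 0, fun x y => ?_⟩, fun s x => hsmul s x⟩, φ 0, by simp⟩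
  -- `x + y` is the midpoint of `2x` and `2y`, which yields additivity.
  have h1 := h ((2 : ℝ) • x) ((2 : ℝ) • y) (1 / 2)
  have e : (2 : ℝ) • x + (1 / 2 : ℝ) • ((2 : ℝ) • y - (2 : ℝ) • x) = x + y := by module
  rw [e] at h1
  have hx := hsmul 2 x
  have hy := hsmul 2 y
  rw [sub_eq_iff_eq_add] at hx hy
  rw [h1, hx, hy]
  module

theorem line {φ : E → F} (h : IsAff φ) (x y : E) (s : ℝ) :
    φ (x + s • (y - x)) = φ x + s • (φ y - φ x) := by
  obtain ⟨L, c, h⟩ := h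
  simp only [h, map_add, map_smul, map_sub]
  module

theorem comp {ψ : F → G} {φ : E → F} (hψ : IsAff ψ) (hφ : IsAff φ) :
    IsAff (fun x => ψ (φ x)) := by
  refine of_line fun x y s => ?_
  rw [hφ.line, hψ.line]

theorem id : IsAff (fun x : E => x) := of_line fun _ _ _ => rfl

theorem const (c : F) : IsAff (fun _ : E => c) := of_line fun _ _ _ => by simp

theorem fst {φ : E → F × G} (h : IsAff φ) : IsAff (fun x => (φ x).1) :=
  comp (of_linear (LinearMap.fst ℝ F G)) h

theorem snd {φ : E → F × G} (h : IsAff φ) : IsAff (fun x => (φ x).2) :=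
  comp (of_linear (LinearMap.snd ℝ F G)) h

theorem prodMk {φ : E → F} {ψ : E → G} (hφ : IsAff φ) (hψ : IsAff ψ) :
    IsAff (fun x => (φ x, ψ x)) :=
  of_line fun x y s => by ext <;> simp [hφ.line, hψ.line]

theorem pi {I : Type*} {H : I → Type*} [∀ i, AddCommGroup (H i)] [∀ i, Module ℝ (H i)]
    {φ : E → ∀ i, H i} (h : ∀ i, IsAff (fun x => φ x i)) : IsAff φ :=
  of_line fun x y s => by ext i; simpa using (h i).line x y s

theorem apply {I : Type*} {H : I → Type*} [∀ i, AddCommGroup (H i)] [∀ i, Module ℝ (H i)]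
    {φ : E → ∀ i, H i} (h : IsAff φ) (i : I) : IsAff (fun x => φ x i) :=
  comp (of_linear (LinearMap.proj i)) h

theorem add {φ ψ : E → F} (hφ : IsAff φ) (hψ : IsAff ψ) : IsAff (fun x => φ x + ψ x) :=
  of_line fun x y s => by rw [hφ.line, hψ.line]; module

theorem sub {φ ψ : E → F} (hφ : IsAff φ) (hψ : IsAff ψ) : IsAff (fun x => φ x - ψ x) :=
  of_line fun x y s => by rw [hφ.line, hψ.line]; module

theorem sum {I : Type*} (t : Finset I) {φ : I → E → F} (h : ∀ i, IsAff (φ i)) :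
    IsAff (fun x => ∑ i ∈ t, φ i x) := by
  classical
  induction t using Finset.induction_on with
  | empty => simpa using const 0
  | insert a t ha ih => simpa [Finset.sum_insert ha] using (h a).add ih

theorem mul_const {φ : E → ℝ} (hφ : IsAff φ) (c : ℝ) : IsAff (fun x => φ x * c) :=
  of_line fun x y s => by rw [hφ.line]; simp; ring

theorem const_mul {φ : E → ℝ} (hφ : IsAff φ) (c : ℝ) : IsAff (fun x => c * φ x) :=
  of_line fun x y s => by rw [hφ.line]; simp; ring

theorem dotProduct_const {I : Type*} [Fintype I] {φ : E → I → ℝ} (h : IsAff φ) (c : I → ℝ) :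
    IsAff (fun x => φ x ⬝ᵥ c) :=
  sum _ fun i => (h.apply i).mul_const (c i)

theorem const_dotProduct {I : Type*} [Fintype I] {φ : E → I → ℝ} (h : IsAff φ) (c : I → ℝ) :
    IsAff (fun x => c ⬝ᵥ φ x) :=
  sum _ fun i => (h.apply i).const_mul (c i)

theorem mulVec {I J : Type*} [Fintype I] {φ : E → I → ℝ} (h : IsAff φ) (A : Matrix J I ℝ) :
    IsAff (fun x => A.mulVec (φ x)) :=
  pi fun i => h.const_dotProduct (A i)

theorem sumElim {I J : Type*} {φ : E → I → ℝ} {ψ : E → J → ℝ} (hφ : IsAff φ) (hψ : IsAff ψ) :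
    IsAff (fun x => Sum.elim (φ x) (ψ x)) :=
  pi fun i => by cases i with
    | inl i => exact hφ.apply i
    | inr i => exact hψ.apply i

theorem exists_matrix {I J : Type*} [Fintype I] {φ : (I → ℝ) → J → ℝ} (h : IsAff φ) :
    ∃ (A : Matrix J I ℝ) (b : J → ℝ), ∀ x, φ x = A.mulVec x - b := by
  classical
  obtain ⟨L, c, h⟩ := h
  refine ⟨fun j i => L (Pi.single i 1) j, -c, fun x => ?_⟩
  rw [h, sub_neg_eq_add]
  congr 1
  conv_lhs => rw [pi_eq_sum_univ' x, map_sum]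
  ext j
  simp [Matrix.mulVec, dotProduct, mul_comm, Finset.sum_apply]

end IsAff

/-! ### Calculus of cone representable sets. -/

/-- `S` is the projection of a set cut out by finitely many constraints requiring an affine
function to take values in a cone from the family `𝒦`. -/
def ConeRep (𝒦 : ∀ m : ℕ, Set (Fin m → ℝ) → Prop) {E : Type*} [AddCommGroup E] [Module ℝ E]
    (S : Set E) : Prop :=
  ∃ (p J : ℕ) (m : Fin J → ℕ) (C : ∀ j, Set (Fin (m j) → ℝ))
    (φ : ∀ j, E × (Fin p → ℝ) → Fin (m j) → ℝ),
    (∀ j, 𝒦 (m j) (C j)) ∧ (∀ j, IsAff (φ j)) ∧ ∀ x, x ∈ S ↔ ∃ v, ∀ j, φ j (x, v) ∈ C j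

namespace ConeRep

variable {𝒦 : ∀ m : ℕ, Set (Fin m → ℝ) → Prop} {E F : Type*} [AddCommGroup E] [Module ℝ E]
  [AddCommGroup F] [Module ℝ F]

/-- Frees later constructions from coordinates: auxiliary variables may live in any
finite-dimensional space and constraints be indexed by any finite type. -/
theorem of_finite {V J : Type*} [AddCommGroup V] [Module ℝ V] [Module.Finite ℝ V] [Finite J]
    {S : Set E} (m : J → ℕ) (C : ∀ j, Set (Fin (m j) → ℝ)) (φ : ∀ j, E × V → Fin (m j) → ℝ)
    (hC : ∀ j, 𝒦 (m j) (C j)) (hφ : ∀ j, IsAff (φ j))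
    (h : ∀ x, x ∈ S ↔ ∃ v, ∀ j, φ j (x, v) ∈ C j) : ConeRep 𝒦 S := by
  have := Fintype.ofFinite J
  let e := (Fintype.equivFin J).symm
  let f : V ≃ₗ[ℝ] (Fin (Module.finrank ℝ V) → ℝ) := (Module.finBasis ℝ V).equivFun
  refine ⟨Module.finrank ℝ V, Fintype.card J, fun j => m (e j), fun j => C (e j),
    fun j p => φ (e j) (p.1, f.symm p.2), fun j => hC _, fun j => ?_, fun x => ?_⟩
  · exact (hφ (e j)).comp (IsAff.id.fst.prodMk
      ((IsAff.of_linear f.symm.toLinearMap).comp IsAff.id.snd))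
  · rw [h]
    constructor
    · rintro ⟨v, hv⟩
      exact ⟨f v, fun j => by simpa using hv (e j)⟩
    · rintro ⟨v, hv⟩
      refine ⟨f.symm v, fun j => ?_⟩
      obtain ⟨i, rfl⟩ := e.surjective j
      exact hv i

theorem comap {S : Set F} (h : ConeRep 𝒦 S) {ψ : E → F} (hψ : IsAff ψ) :
    ConeRep 𝒦 {x | ψ x ∈ S} := by
  obtain ⟨p, J, m, C, φ, hC, hφ, h⟩ := h
  exact ⟨p, J, m, C, fun j x => φ j (ψ x.1, x.2), hC, fun j => (hφ j).comp
    ((hψ.comp IsAff.id.fst).prodMk IsAff.id.snd), fun x => h _⟩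

theorem proj [Module.Finite ℝ F] {S : Set (E × F)} (h : ConeRep 𝒦 S) :
    ConeRep 𝒦 {x | ∃ y, (x, y) ∈ S} := by
  obtain ⟨p, J, m, C, φ, hC, hφ, h⟩ := h
  refine of_finite (V := F × (Fin p → ℝ)) m C (fun j x => φ j ((x.1, x.2.1), x.2.2)) hC
    (fun j => (hφ j).comp ((IsAff.id.fst.prodMk IsAff.id.snd.fst).prodMk IsAff.id.snd.snd)) ?_
  intro x
  simp [h]

theorem forall_mem {I : Type*} [Finite I] {S : I → Set E} (h : ∀ i, ConeRep 𝒦 (S i)) :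
    ConeRep 𝒦 {x | ∀ i, x ∈ S i} := by
  have := Fintype.ofFinite I
  choose p J m C φ hC hφ h using h
  refine of_finite (V := ∀ i, Fin (p i) → ℝ) (J := Σ i, Fin (J i)) (fun j => m j.1 j.2)
    (fun j => C j.1 j.2) (fun j x => φ j.1 j.2 (x.1, x.2 j.1)) (fun j => hC _ _)
    (fun j => (hφ _ _).comp (IsAff.id.fst.prodMk (IsAff.id.snd.apply _))) ?_
  intro x
  simp only [Set.mem_ofPred_eq, h, Sigma.forall]
  exact ⟨fun H => ⟨fun i => (H i).choose, fun i => (H i).choose_spec⟩,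
    fun ⟨v, hv⟩ i => ⟨v i, hv i⟩⟩

theorem and {P Q : E → Prop} (hP : ConeRep 𝒦 {x | P x}) (hQ : ConeRep 𝒦 {x | Q x}) :
    ConeRep 𝒦 {x | P x ∧ Q x} := by
  have := forall_mem (S := fun b : Bool => if b then {x | P x} else {x | Q x})
    (fun b => by cases b <;> simpa)
  convert this using 2
  simp [and_comm]

theorem of_cone {m : ℕ} {C : Set (Fin m → ℝ)} (hC : 𝒦 m C) : ConeRep 𝒦 C :=
  of_finite (V := Fin 0 → ℝ) (J := Unit) (fun _ => m) (fun _ => C) (fun _ x => x.1)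
    (fun _ => hC) (fun _ => IsAff.id.fst) (by simp)

section SecondOrder

variable (hSOC : ∀ m, 𝒦 (m + 1) (secondOrderCone m))
include hSOC

theorem nonneg {φ : E → ℝ} (hφ : IsAff φ) : ConeRep 𝒦 {x | 0 ≤ φ x} := by
  have := (of_cone (hSOC 0)).comap (ψ := fun x (_ : Fin 1) => φ x) (IsAff.pi fun _ => hφ)
  simpa [secondOrderCone] using this

theorem le {φ ψ : E → ℝ} (hφ : IsAff φ) (hψ : IsAff ψ) : ConeRep 𝒦 {x | φ x ≤ ψ x} := by
  simpa using nonneg hSOC (hψ.sub hφ)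

theorem eq {φ ψ : E → ℝ} (hφ : IsAff φ) (hψ : IsAff ψ) : ConeRep 𝒦 {x | φ x = ψ x} := by
  simpa [le_antisymm_iff] using (le hSOC hφ hψ).and (le hSOC hψ hφ)

theorem of_isSOCRepresentable {ι : Type} [Fintype ι] {S : Set (ι → ℝ)}
    (h : IsSOCRepresentable S) : ConeRep 𝒦 S := by
  obtain ⟨p, J, m, A, b, h⟩ := h
  exact ⟨p, J, fun j => m j + 1, fun j => secondOrderCone (m j),
    fun j x => (A j).mulVec (Sum.elim x.1 x.2) - b j, fun j => hSOC _,
    fun j => ((IsAff.id.fst.sumElim IsAff.id.snd).mulVec _).sub (IsAff.const _), h⟩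

end SecondOrder

/-- A set in `(x, τ)`-space whose sections over `x` have least element `f x` describes a linear
cone program. -/
theorem exists_linearConeProgram {ι : Type} [Fintype ι] {G : Set ((ι → ℝ) × ℝ)}
    (hG : ConeRep 𝒦 G) :
    ∃ Q : LinearConeProgram 𝒦 ι, ∀ x (τ : ℝ), (x, τ) ∈ G ↔ ∃ w, Q.Feasible x w ∧ τ = Q.value x w := by
  classical
  obtain ⟨p, J, m, C, φ, hC, hφ, h⟩ := hG
  have aux : ∀ j, IsAff (fun u : ι ⊕ Fin (p + 1) → ℝ => φ j (((fun i => u (Sum.inl i)),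
      u (Sum.inr 0)), fun i => u (Sum.inr i.succ))) := fun j =>
    (hφ j).comp (((IsAff.pi fun i => IsAff.id.apply _).prodMk (IsAff.id.apply _)).prodMk
      (IsAff.pi fun i => IsAff.id.apply _))
  choose A b hAb using fun j => (aux j).exists_matrix
  -- The first auxiliary variable is `τ`, and the objective is that coordinate.
  refine ⟨⟨p + 1, J, m, C, hC, A, b, Pi.single (Sum.inr 0) 1⟩, fun x τ => ?_⟩
  rw [h]
  simp only [LinearConeProgram.Feasible, LinearConeProgram.value, ← hAb, single_dotProduct,
    Sum.elim_inr, Sum.elim_inl, one_mul]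
  constructor
  · rintro ⟨v, hv⟩
    exact ⟨Fin.cons τ v, by simpa using hv, by simp⟩
  · rintro ⟨w, hw, rfl⟩
    exact ⟨_, hw⟩

theorem isLinearConeProgram {ι : Type} [Fintype ι] {G : Set ((ι → ℝ) × ℝ)} (hG : ConeRep 𝒦 G)
    {X : Set (ι → ℝ)} {f : (ι → ℝ) → EReal} (hX : ∀ x τ, (x, τ) ∈ G → x ∈ X)
    (hf : ∀ x ∈ X, ∃ F : ℝ, f x = F ∧ IsLeast {τ | (x, τ) ∈ G} F) :
    IsLinearConeProgram 𝒦 X f := by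
  obtain ⟨Q, hQ⟩ := hG.exists_linearConeProgram
  refine ⟨Q, fun x => ⟨fun hx => ?_, fun ⟨w, hw⟩ => hX x _ ((hQ x _).2 ⟨w, hw, rfl⟩)⟩,
    fun x hx => ?_⟩
  · obtain ⟨F, -, hF, -⟩ := hf x hx
    obtain ⟨w, hw, -⟩ := (hQ x F).1 hF
    exact ⟨w, hw⟩
  · obtain ⟨F, hfF, hF, hle⟩ := hf x hx
    obtain ⟨w, hw, e⟩ := (hQ x F).1 hF
    rw [hfF]
    refine ⟨⟨w, hw, by rw [e]⟩, ?_⟩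
    rintro _ ⟨w', hw', rfl⟩
    exact EReal.coe_le_coe_iff.2 (hle ((hQ x _).2 ⟨w', hw', rfl⟩))

/-- The sections of `G` matter only at points with binary `x_d`; elsewhere nothing is known about
the cost, and nothing is needed. -/
theorem isMixedIntegerLinearConeProgram {n₁ n₂ : ℕ} {G : Set ((Fin n₁ ⊕ Fin n₂ → ℝ) × ℝ)}
    (hG : ConeRep 𝒦 G) {X : Set (Fin n₁ ⊕ Fin n₂ → ℝ)} {f : (Fin n₁ ⊕ Fin n₂ → ℝ) → EReal}
    (hX : ∀ x τ, (x, τ) ∈ G → x ∈ X)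
    (hf : ∀ x ∈ mixedBinaryRegion X, ∃ F : ℝ, f x = F ∧ IsLeast {τ | (x, τ) ∈ G} F) :
    IsMixedIntegerLinearConeProgram 𝒦 (mixedBinaryRegion X) f := by
  obtain ⟨Q, hQ⟩ := hG.exists_linearConeProgram
  refine ⟨Q, fun x => ⟨fun hx => ⟨hx.2, ?_⟩,
    fun ⟨hb, w, hw⟩ => ⟨hX x _ ((hQ x _).2 ⟨w, hw, rfl⟩), hb⟩⟩, fun x hx => ?_⟩
  · obtain ⟨F, -, hF, -⟩ := hf x hx
    obtain ⟨w, hw, -⟩ := (hQ x F).1 hF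
    exact ⟨w, hw⟩
  · obtain ⟨F, hfF, hF, hle⟩ := hf x hx
    obtain ⟨w, hw, e⟩ := (hQ x F).1 hF
    rw [hfF]
    refine ⟨⟨w, hw, by rw [e]⟩, ?_⟩
    rintro _ ⟨w', hw', rfl⟩
    exact EReal.coe_le_coe_iff.2 (hle ((hQ x _).2 ⟨w', hw', rfl⟩))

end ConeRep

/-! ### Conic duality under Slater's condition. -/

/-- Conic Farkas lemma under Slater's condition. -/
theorem exists_multiplier_of_slater {V Y : Type*} [AddCommGroup V] [Module ℝ V]
    [NormedAddCommGroup Y] [NormedSpace ℝ Y] {O : Set Y} (hO : IsOpen O) (hconv : Convex ℝ O)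
    (hcone : ∀ s : ℝ, 0 < s → ∀ y ∈ O, s • y ∈ O) {f : V → Y} (hf : IsAff f) {a : V → ℝ}
    (ha : IsAff a) {u₀ : V} (hu₀ : f u₀ ∈ O) (h : ∀ u, f u ∈ O → 0 ≤ a u) :
    ∃ z : Y →L[ℝ] ℝ, (∀ y ∈ O, 0 ≤ z y) ∧ ∀ u, z (f u) ≤ a u := by
  have hB : Convex ℝ (Set.range fun u => (f u, a u)) := by
    rw [convex_iff_add_mem]
    rintro _ ⟨u, rfl⟩ _ ⟨v, rfl⟩ s t hs ht hst
    refine ⟨u + t • (v - u), ?_⟩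
    obtain rfl : s = 1 - t := by linarith
    simp only [hf.line, ha.line]
    ext <;> simp
    · module
    · ring
  have hdisj : Disjoint (O ×ˢ Set.Iio (0 : ℝ)) (Set.range fun u => (f u, a u)) := by
    rw [Set.disjoint_left]
    rintro _ ⟨h1, h2⟩ ⟨u, rfl⟩
    exact absurd (h u h1) (not_le.2 h2)
  -- Homogeneity of `O` will force `c ≥ 0` and `φ ≤ 0` on `O`, and the Slater point forces `φ (0, 1)
  -- > 0`, so that normalizing by it gives the multiplier.
  obtain ⟨φ, c, hA, hB⟩ := geometric_hahn_banach_open (hconv.prod (convex_Iio 0))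
    (hO.prod isOpen_Iio) hB hdisj
  have key : ∀ y ∈ O, ∀ s : ℝ, φ (y, s) = φ (y, 0) + s * φ (0, 1) := by
    intro y _ s
    have : (y, s) = (y, (0 : ℝ)) + s • ((0 : Y), (1 : ℝ)) := by ext <;> simp
    rw [this, map_add, map_smul, smul_eq_mul]
  have keyA : ∀ y ∈ O, ∀ s : ℝ, 0 < s → ∀ r : ℝ, 0 < r → r * (φ (y, 0) - s * φ (0, 1)) < c := by
    intro y hy s hs r hr
    have := hA (r • y, -(r * s)) ⟨hcone r hr y hy, by simpa using mul_pos hr hs⟩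
    have e : (r • y, -(r * s)) = r • (y, -s) := by ext <;> simp
    rw [e, map_smul, key y hy, smul_eq_mul] at this
    linarith
  have hc : 0 ≤ c := by
    by_contra hc
    push Not at hc
    set q := φ (f u₀, 0) - 1 * φ (0, 1)
    have hq : q < 0 := by have := keyA _ hu₀ 1 one_pos 1 one_pos; linarith
    have := keyA _ hu₀ 1 one_pos (c / q / 2) (by have := div_pos_of_neg_of_neg hc hq; linarith)
    change c / q / 2 * q < c at this
    have e : c / q / 2 * q = c / 2 := by
      have := hq.ne
      field_simp
    linarith
  have hle : ∀ y ∈ O, ∀ s : ℝ, 0 < s → φ (y, 0) - s * φ (0, 1) ≤ 0 := by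
    intro y hy s hs
    by_contra hq
    push Not at hq
    set q := φ (y, 0) - s * φ (0, 1)
    have := keyA y hy s hs ((c + 1) / q) (by positivity)
    change (c + 1) / q * q < c at this
    rw [div_mul_cancel₀ _ hq.ne'] at this
    linarith
  have hle0 : ∀ y ∈ O, φ (y, 0) ≤ 0 := by
    intro y hy
    refine le_of_forall_pos_le_add fun δ hδ => ?_
    have hs : (0 : ℝ) < δ / (|φ (0, 1)| + 1) := by positivity
    have := hle y hy _ hs
    have h2 : δ / (|φ (0, 1)| + 1) * φ (0, 1) ≤ δ := by
      rw [div_mul_eq_mul_div, div_le_iff₀ (by positivity)]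
      nlinarith [le_abs_self (φ (0, 1))]
    linarith
  have hφB : ∀ u, c ≤ φ (f u, 0) + a u * φ (0, 1) := by
    intro u
    have := hB _ ⟨u, rfl⟩
    have e : (f u, a u) = (f u, (0 : ℝ)) + a u • ((0 : Y), (1 : ℝ)) := by ext <;> simp
    simp only [e, map_add, map_smul, smul_eq_mul] at this
    exact this
  have hα : 0 < φ (0, 1) := by
    by_contra hα
    push Not at hα
    have h1 := keyA _ hu₀ 1 one_pos 1 one_pos
    have h2 := hφB u₀
    have h3 := h u₀ hu₀
    have h4 := keyA _ hu₀ (a u₀ + 1) (by linarith) 1 one_pos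
    nlinarith
  refine ⟨-((φ (0, 1))⁻¹ • (φ.comp (ContinuousLinearMap.inl ℝ Y ℝ))), fun y hy => ?_, fun u => ?_⟩
  · have := hle0 y hy
    simp only [neg_apply, smul_apply, smul_eq_mul,
      ContinuousLinearMap.comp_apply, ContinuousLinearMap.inl_apply]
    have := inv_pos.2 hα
    nlinarith
  · have := hφB u
    simp only [neg_apply, smul_apply, smul_eq_mul,
      ContinuousLinearMap.comp_apply, ContinuousLinearMap.inl_apply]
    rw [neg_le_iff_add_nonneg, ← mul_le_mul_iff_right₀ hα]
    rw [mul_zero, mul_add, mul_inv_cancel_left₀ hα.ne']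
    linarith

/-- The conic Farkas lemma for a product of cones. -/
theorem exists_multipliers_of_slater {V J : Type*} [AddCommGroup V] [Module ℝ V] [Fintype J]
    {m : J → ℕ} {O : ∀ j, Set (Fin (m j) → ℝ)} (hO : ∀ j, IsOpen (O j))
    (hconv : ∀ j, Convex ℝ (O j)) (hcone : ∀ j, ∀ s : ℝ, 0 < s → ∀ y ∈ O j, s • y ∈ O j)
    {f : ∀ j, V → Fin (m j) → ℝ} (hf : ∀ j, IsAff (f j)) {a : V → ℝ} (ha : IsAff a) {u₀ : V}
    (hu₀ : ∀ j, f j u₀ ∈ O j) (h : ∀ u, (∀ j, f j u ∈ O j) → 0 ≤ a u) :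
    ∃ z : ∀ j, Fin (m j) → ℝ, (∀ j, ∀ y ∈ O j, 0 ≤ z j ⬝ᵥ y) ∧
      ∀ u, ∑ j, z j ⬝ᵥ f j u ≤ a u := by
  classical
  obtain ⟨φ, hφ, hφa⟩ := exists_multiplier_of_slater (O := Set.pi Set.univ O)
    (isOpen_set_pi Set.finite_univ fun j _ => hO j) (convex_pi fun j _ => hconv j)
    (fun s hs y hy j _ => hcone j s hs _ (hy j trivial)) (f := fun u j => f j u)
    (IsAff.pi hf) ha (u₀ := u₀) (fun j _ => hu₀ j) (fun u hu => h u fun j => hu j trivial)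
  let z : ∀ j, Fin (m j) → ℝ := fun j i => φ (Pi.single j (Pi.single i 1))
  have hz : ∀ y : ∀ j, Fin (m j) → ℝ, φ y = ∑ j, z j ⬝ᵥ y j := by
    intro y
    have h1 : ∀ j, φ (Pi.single j (y j)) = z j ⬝ᵥ y j := by
      intro j
      conv_lhs => rw [pi_eq_sum_univ' (y j)]
      have : φ (Pi.single j (∑ i, y j i • Pi.single i (1 : ℝ))) =
          (φ.toLinearMap ∘ₗ LinearMap.single ℝ (fun j => Fin (m j) → ℝ) j)
            (∑ i, y j i • Pi.single i (1 : ℝ)) := rfl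
      rw [this, map_sum]
      simp [z, dotProduct, mul_comm]
    conv_lhs => rw [← Finset.univ_sum_single y, map_sum]
    simp [h1]
  refine ⟨z, fun j y hy => ?_, fun u => (hz _).symm.le.trans (hφa u)⟩
  by_contra hneg
  push Not at hneg
  -- Only component `j` is scaled. The others stay at the Slater point, since `0` need not lie in `O
  -- i`.
  set b := ∑ i ∈ Finset.univ.erase j, z i ⬝ᵥ f i u₀ with hb
  have key : ∀ s : ℝ, 0 < s → 0 ≤ s * (z j ⬝ᵥ y) + b := by
    intro s hs
    have := hφ (Function.update (fun i => f i u₀) j (s • y)) (by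
      intro i _
      by_cases hi : i = j
      · subst hi; simpa using hcone _ s hs y hy
      · simpa [hi] using hu₀ i)
    rw [hz, ← Finset.add_sum_erase _ _ (Finset.mem_univ j)] at this
    simp only [Function.update_self, dotProduct_smul, smul_eq_mul] at this
    convert this using 2
    refine Finset.sum_congr rfl fun i hi => ?_
    rw [Function.update_of_ne (Finset.ne_of_mem_erase hi)]
  have h1 := key ((|b| + 1) / -(z j ⬝ᵥ y)) (div_pos (by positivity) (by linarith))
  have h2 : (|b| + 1) / -(z j ⬝ᵥ y) * (z j ⬝ᵥ y) = -(|b| + 1) := by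
    field_simp [hneg.ne]
  linarith [le_abs_self b]

/-- A finite family of conditions, each inherited by midpoints with points of a convex set, has a
point of the set satisfying all those conditions that hold somewhere on the set. -/
theorem exists_forall_of_midpoint {W I : Type*} [AddCommGroup W] [Module ℝ W] [Finite I]
    {F : Set W} (hF : Convex ℝ F) (hne : F.Nonempty) (Q : I → W → Prop)
    (hQ : ∀ i, ∀ w ∈ F, ∀ w' ∈ F, Q i w → Q i (midpoint ℝ w w')) :
    ∃ w ∈ F, ∀ i, (∃ w' ∈ F, Q i w') → Q i w := by
  classical
  have := Fintype.ofFinite I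
  suffices H : ∀ s : Finset I, ∃ w ∈ F, ∀ i ∈ s, (∃ w' ∈ F, Q i w') → Q i w by
    simpa using H Finset.univ
  intro s
  induction s using Finset.induction_on with
  | empty => exact ⟨hne.some, hne.some_mem, by simp⟩
  | insert a s ha ih =>
    obtain ⟨w, hw, h⟩ := ih
    by_cases hex : ∃ w' ∈ F, Q a w'
    · obtain ⟨w', hw', hq⟩ := hex
      refine ⟨midpoint ℝ w w', hF.midpoint_mem hw hw', fun i hi hi' => ?_⟩
      rcases Finset.mem_insert.1 hi with rfl | hi
      · rw [midpoint_comm]; exact hQ _ _ hw' _ hw hq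
      · exact hQ _ _ hw _ hw' (h i hi hi')
    · refine ⟨w, hw, fun i hi hi' => ?_⟩
      rcases Finset.mem_insert.1 hi with rfl | hi
      · exact absurd hi' hex
      · exact h i hi hi'

/-! ### Geometry of the second-order cone and its faces. -/

/-- The interior of the second-order cone. -/
def openSecondOrderCone (m : ℕ) : Set (Fin (m + 1) → ℝ) :=
  {y | Real.sqrt (∑ i : Fin m, y i.castSucc ^ 2) < y (Fin.last m)}

/-- The first `m` coordinates as a vector of the Euclidean space. -/
noncomputable def initE {m : ℕ} (y : Fin (m + 1) → ℝ) : EuclideanSpace ℝ (Fin m) :=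
  WithLp.toLp 2 fun i => y i.castSucc

theorem norm_initE {m : ℕ} (y : Fin (m + 1) → ℝ) :
    ‖initE y‖ = Real.sqrt (∑ i : Fin m, y i.castSucc ^ 2) := by
  simp [initE, EuclideanSpace.norm_eq]

theorem initE_add {m : ℕ} (y z : Fin (m + 1) → ℝ) : initE (y + z) = initE y + initE z := by
  ext; simp [initE]

theorem initE_smul {m : ℕ} (s : ℝ) (y : Fin (m + 1) → ℝ) : initE (s • y) = s • initE y := by
  ext; simp [initE]

theorem mem_secondOrderCone {m : ℕ} {y : Fin (m + 1) → ℝ} :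
    y ∈ secondOrderCone m ↔ ‖initE y‖ ≤ y (Fin.last m) := by
  rw [norm_initE]; rfl

theorem mem_openSecondOrderCone {m : ℕ} {y : Fin (m + 1) → ℝ} :
    y ∈ openSecondOrderCone m ↔ ‖initE y‖ < y (Fin.last m) := by
  rw [norm_initE]; rfl

theorem ext_initE {m : ℕ} {y z : Fin (m + 1) → ℝ} (h : initE y = initE z)
    (h' : y (Fin.last m) = z (Fin.last m)) : y = z := by
  ext i
  refine Fin.lastCases h' (fun i => ?_) i
  simpa [initE] using congrArg (fun v : EuclideanSpace ℝ (Fin m) => v i) h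

theorem isOpen_openSecondOrderCone (m : ℕ) : IsOpen (openSecondOrderCone m) :=
  isOpen_lt (by fun_prop) (by fun_prop)

theorem isClosed_secondOrderCone (m : ℕ) : IsClosed (secondOrderCone m) :=
  isClosed_le (by fun_prop) (by fun_prop)

theorem add_mem_openSecondOrderCone {m : ℕ} {y z : Fin (m + 1) → ℝ} (hy : y ∈ secondOrderCone m)
    (hz : z ∈ openSecondOrderCone m) : y + z ∈ openSecondOrderCone m := by
  rw [mem_secondOrderCone] at hy
  rw [mem_openSecondOrderCone] at *
  rw [initE_add]
  exact (norm_add_le _ _).trans_lt (add_lt_add_of_le_of_lt hy hz)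

theorem smul_mem_openSecondOrderCone {m : ℕ} {s : ℝ} (hs : 0 < s) {y : Fin (m + 1) → ℝ}
    (hy : y ∈ openSecondOrderCone m) : s • y ∈ openSecondOrderCone m := by
  rw [mem_openSecondOrderCone] at *
  rw [initE_smul, norm_smul, Real.norm_of_nonneg hs.le]
  exact mul_lt_mul_of_pos_left hy hs

theorem smul_mem_secondOrderCone {m : ℕ} {s : ℝ} (hs : 0 ≤ s) {y : Fin (m + 1) → ℝ}
    (hy : y ∈ secondOrderCone m) : s • y ∈ secondOrderCone m := by
  rw [mem_secondOrderCone] at *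
  rw [initE_smul, norm_smul, Real.norm_of_nonneg hs]
  exact mul_le_mul_of_nonneg_left hy hs

theorem add_mem_secondOrderCone {m : ℕ} {y z : Fin (m + 1) → ℝ} (hy : y ∈ secondOrderCone m)
    (hz : z ∈ secondOrderCone m) : y + z ∈ secondOrderCone m := by
  rw [mem_secondOrderCone] at *
  rw [initE_add]
  exact (norm_add_le _ _).trans (add_le_add hy hz)

theorem convex_secondOrderCone (m : ℕ) : Convex ℝ (secondOrderCone m) :=
  fun _ hx _ hy _ _ hs ht _ =>
    add_mem_secondOrderCone (smul_mem_secondOrderCone hs hx) (smul_mem_secondOrderCone ht hy)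

theorem openSecondOrderCone_subset (m : ℕ) : openSecondOrderCone m ⊆ secondOrderCone m :=
  fun _ h => le_of_lt (Set.mem_ofPred_eq ▸ h)

theorem last_nonneg_of_mem {m : ℕ} {y : Fin (m + 1) → ℝ} (hy : y ∈ secondOrderCone m) :
    0 ≤ y (Fin.last m) :=
  (Real.sqrt_nonneg _).trans hy

theorem eq_zero_of_mem_of_last {m : ℕ} {y : Fin (m + 1) → ℝ} (hy : y ∈ secondOrderCone m)
    (h : y (Fin.last m) = 0) : y = 0 := by
  rw [mem_secondOrderCone, h] at hy
  refine ext_initE ?_ (by simpa using h)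
  rw [norm_le_zero_iff.1 hy]
  ext; simp [initE]

/-- Two points of the second-order cone whose sum is not interior are parallel. -/
theorem mem_span_of_add_notMem {m : ℕ} {p r : Fin (m + 1) → ℝ} (hp : p ∈ secondOrderCone m)
    (hr : r ∈ secondOrderCone m) (hr0 : 0 < r (Fin.last m))
    (h : p + r ∉ openSecondOrderCone m) : p ∈ Submodule.span ℝ {r} := by
  rw [mem_secondOrderCone] at hp hr
  rw [mem_openSecondOrderCone, initE_add, not_lt] at h
  have h1 := norm_add_le (initE p) (initE r)
  simp only [Pi.add_apply] at h
  -- Not being interior forces equality in both cone inequalities and in the triangle inequality;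
  -- strict convexity of the Euclidean norm then gives parallelism.
  have hpe : ‖initE p‖ = p (Fin.last m) := by linarith
  have hre : ‖initE r‖ = r (Fin.last m) := by linarith
  have hsum : ‖initE p + initE r‖ = ‖initE p‖ + ‖initE r‖ := by linarith
  have hray := (sameRay_iff_norm_add.2 hsum)
  rw [sameRay_iff_norm_smul_eq] at hray
  rw [Submodule.mem_span_singleton]
  refine ⟨p (Fin.last m) / r (Fin.last m), ext_initE ?_ ?_⟩
  · rw [initE_smul, ← hpe, ← hre, div_eq_inv_mul, mul_smul, hray, smul_smul, inv_mul_cancel₀, one_smul]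
    rw [hre]; exact hr0.ne'
  · simp [hr0.ne']

/-- The second-order cone is self-dual. -/
theorem forall_dotProduct_nonneg_iff {m : ℕ} {z : Fin (m + 1) → ℝ} :
    (∀ y ∈ openSecondOrderCone m, 0 ≤ z ⬝ᵥ y) ↔ z ∈ secondOrderCone m := by
  have hdot : ∀ y : Fin (m + 1) → ℝ,
      z ⬝ᵥ y = inner ℝ (initE z) (initE y) + z (Fin.last m) * y (Fin.last m) := by
    intro y
    simp [dotProduct, Fin.sum_univ_castSucc, initE, PiLp.inner_apply, mul_comm]
  rw [mem_secondOrderCone]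
  constructor
  · intro h
    refine le_of_forall_pos_le_add fun δ hδ => ?_
    -- The test vector reflects the leading part of `z`; the extra `η` puts it in the interior.
    have hy : ∀ η : ℝ, 0 < η →
        0 ≤ -(‖initE z‖ * ‖initE z‖) + z (Fin.last m) * (‖initE z‖ + η) := by
      intro η hη
      have e1 : initE (Fin.snoc (fun i : Fin m => -z i.castSucc) (‖initE z‖ + η)) = - initE z := by
        ext i; simp [initE]
      have := h (Fin.snoc (fun i => -z i.castSucc) (‖initE z‖ + η)) (by
        rw [mem_openSecondOrderCone, e1, norm_neg, Fin.snoc_last]; linarith)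
      rw [hdot, e1, inner_neg_right, real_inner_self_eq_norm_mul_norm, Fin.snoc_last] at this
      exact this
    have hlast : 0 ≤ z (Fin.last m) := by
      by_contra hneg
      push Not at hneg
      have := hy 1 one_pos
      nlinarith [norm_nonneg (initE z)]
    by_contra hcon
    push Not at hcon
    have hpos : 0 < ‖initE z‖ := by linarith
    have h1 := hy (δ * ‖initE z‖ / (z (Fin.last m) + 1) / 2) (by positivity)
    have h2 : z (Fin.last m) * (δ * ‖initE z‖ / (z (Fin.last m) + 1) / 2) ≤ δ * ‖initE z‖ := by
      rw [div_div, mul_div_assoc', div_le_iff₀ (by positivity)]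
      nlinarith [mul_pos hδ hpos]
    nlinarith
  · intro h y hy
    rw [mem_openSecondOrderCone] at hy
    rw [hdot]
    have h1 := abs_real_inner_le_norm (initE z) (initE y)
    have h2 := neg_abs_le (inner ℝ (initE z) (initE y))
    have h3 : ‖initE z‖ * ‖initE y‖ ≤ z (Fin.last m) * y (Fin.last m) :=
      mul_le_mul h hy.le (norm_nonneg _) ((norm_nonneg _).trans h)
    linarith

/-- The data of one step of facial reduction at a point `r` of the second-order cone: an open
convex cone `O ∋ r` with representable dual and a subspace `T ∋ r` such that `T ∩ O` lies in the
second-order cone and `secondOrderCone + O ⊆ O`. -/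
theorem exists_open_cone_of_mem {𝒦 : ∀ m : ℕ, Set (Fin m → ℝ) → Prop}
    (hSOC : ∀ m, 𝒦 (m + 1) (secondOrderCone m)) {m : ℕ} {r : Fin (m + 1) → ℝ}
    (hr : r ∈ secondOrderCone m) :
    ∃ (O : Set (Fin (m + 1) → ℝ)) (T : Submodule ℝ (Fin (m + 1) → ℝ)),
      IsOpen O ∧ Convex ℝ O ∧ (∀ s : ℝ, 0 < s → ∀ y ∈ O, s • y ∈ O) ∧ r ∈ O ∧ r ∈ T ∧
      (∀ y ∈ T, y ∈ O → y ∈ secondOrderCone m) ∧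
      (∀ y ∈ secondOrderCone m, ∀ y' ∈ O, y + y' ∈ O) ∧
      ConeRep 𝒦 {z : Fin (m + 1) → ℝ | ∀ y ∈ O, 0 ≤ z ⬝ᵥ y} ∧
      (∀ p ∈ secondOrderCone m, (r ∉ openSecondOrderCone m → p + r ∉ openSecondOrderCone m) →
        (¬ 0 < r (Fin.last m) → ¬ 0 < p (Fin.last m)) → p ∈ T) := by
  -- Interior point: no reduction, and the dual is the cone itself by self-duality.
  by_cases h1 : r ∈ openSecondOrderCone m
  · refine ⟨openSecondOrderCone m, ⊤, isOpen_openSecondOrderCone m, ?_,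
      fun s hs y hy => smul_mem_openSecondOrderCone hs hy, h1, trivial,
      fun y _ hy => openSecondOrderCone_subset m hy,
      fun y hy y' hy' => add_mem_openSecondOrderCone hy hy', ?_, fun _ _ _ _ => trivial⟩
    · intro x hx y hy s t hs ht hst
      rcases hs.eq_or_lt with rfl | hs
      · obtain rfl : t = 1 := by linarith
        simpa using hy
      rw [add_comm (s • x)]
      exact add_mem_openSecondOrderCone (smul_mem_secondOrderCone ht
        (openSecondOrderCone_subset m hy)) (smul_mem_openSecondOrderCone hs hx)
    · simp_rw [forall_dotProduct_nonneg_iff]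
      exact ConeRep.of_cone (hSOC m)
  -- Nonzero boundary point: the minimal face is the ray of `r`, cut out of its span by an open
  -- half-space, whose dual is a single ray.
  by_cases h2 : 0 < r (Fin.last m)
  · refine ⟨{y | 0 < y (Fin.last m)}, Submodule.span ℝ {r}, isOpen_lt (by fun_prop) (by fun_prop),
      ?_, ?_, h2, Submodule.mem_span_singleton_self r, ?_, ?_, ?_, ?_⟩
    · exact convex_halfSpace_gt (LinearMap.isLinear (LinearMap.proj (Fin.last m))) 0
    · intro s hs y hy
      exact mul_pos hs hy
    · intro y hyT hy
      obtain ⟨s, rfl⟩ := Submodule.mem_span_singleton.1 hyT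
      exact smul_mem_secondOrderCone (pos_of_mul_pos_left hy h2.le).le hr
    · intro y hy y' hy'
      exact add_pos_of_nonneg_of_pos (last_nonneg_of_mem hy) hy'
    · have e : {z : Fin (m + 1) → ℝ | ∀ y ∈ {y : Fin (m + 1) → ℝ | 0 < y (Fin.last m)}, 0 ≤ z ⬝ᵥ y} =
          {z | (∀ i : Fin m, z i.castSucc = 0) ∧ 0 ≤ z (Fin.last m)} := by
        ext z
        simp only [Set.mem_ofPred_eq, dotProduct, Fin.sum_univ_castSucc]
        constructor
        · intro h
          have hz : ∀ i : Fin m, z i.castSucc = 0 := by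
            intro i
            by_contra hi
            have := h (Fin.snoc (Pi.single i (-(|z (Fin.last m)| + 1) / z i.castSucc)) 1)
              (by simp)
            simp only [Fin.snoc_castSucc, Fin.snoc_last, Pi.single_apply, mul_ite, mul_zero,
              Finset.sum_ite_eq', Finset.mem_univ, if_true, mul_one] at this
            rw [mul_div_cancel₀ _ hi] at this
            linarith [le_abs_self (z (Fin.last m))]
          refine ⟨hz, ?_⟩
          simpa [hz] using h (fun _ => 1) one_pos
        · rintro ⟨hz, hl⟩ y hy
          simpa [hz] using mul_nonneg hl hy.le
      rw [e]
      exact (ConeRep.forall_mem fun i => ConeRep.eq hSOC (IsAff.id.apply _) (IsAff.const 0)).and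
        (ConeRep.nonneg hSOC (IsAff.id.apply _))
    · intro p hp hpr _
      exact mem_span_of_add_notMem hp hr h2 (hpr h1)
  -- Apex: the face is `{0}`; the whole space serves as `O`, with dual `{0}`.
  · have hr0 : r = 0 := eq_zero_of_mem_of_last hr (le_antisymm (not_lt.1 h2) (last_nonneg_of_mem hr))
    refine ⟨Set.univ, ⊥, isOpen_univ, convex_univ, by simp, trivial, by simp [hr0], ?_, by simp,
      ?_, ?_⟩
    · intro y hy _
      rw [(Submodule.mem_bot ℝ).1 hy, ← hr0]
      exact hr
    · have e : {z : Fin (m + 1) → ℝ | ∀ y ∈ (Set.univ : Set (Fin (m + 1) → ℝ)), 0 ≤ z ⬝ᵥ y} =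
          {z | ∀ i, z i = 0} := by
        ext z
        simp only [Set.mem_ofPred_eq, Set.mem_univ, true_imp_iff]
        constructor
        · intro h i
          have h3 := h (Pi.single i 1)
          have h4 := h (-Pi.single i 1)
          simp at h3 h4
          linarith
        · intro h y
          simp [dotProduct, h]
      rw [e]
      exact ConeRep.forall_mem fun i => ConeRep.eq hSOC (IsAff.id.apply _) (IsAff.const 0)
    · intro p hp _ hl
      exact (Submodule.mem_bot ℝ).2 (eq_zero_of_mem_of_last hp
        (le_antisymm (not_lt.1 (hl h2)) (last_nonneg_of_mem hp)))

/-! ### Representability of valid affine inequalities. -/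

namespace ConeRep

variable {𝒦 : ∀ m : ℕ, Set (Fin m → ℝ) → Prop} {E : Type*} [AddCommGroup E] [Module ℝ E]

/-- An affine function bounded below on a whole vector space is constant, so equalities at a basis
and one sign condition replace infinitely many inequalities. -/
theorem forall_nonneg (hSOC : ∀ m, 𝒦 (m + 1) (secondOrderCone m)) {V : Type*} [AddCommGroup V]
    [Module ℝ V] [Module.Finite ℝ V] {Φ : E → V → ℝ} (h1 : ∀ u, IsAff fun x => Φ x u)
    (h2 : ∀ x, IsAff (Φ x)) : ConeRep 𝒦 {x | ∀ u, 0 ≤ Φ x u} := by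
  let e := Module.finBasis ℝ V
  have : {x | ∀ u, 0 ≤ Φ x u} = {x | (∀ i, Φ x (e i) = Φ x 0) ∧ 0 ≤ Φ x 0} := by
    ext x
    constructor
    · intro h
      refine ⟨fun i => ?_, h 0⟩
      by_contra hne
      have hne' : Φ x (e i) - Φ x 0 ≠ 0 := sub_ne_zero.2 hne
      have := h (0 + (-(Φ x 0 + 1) / (Φ x (e i) - Φ x 0)) • (e i - 0))
      rw [(h2 x).line, smul_eq_mul, div_mul_cancel₀ _ hne'] at this
      linarith
    · rintro ⟨h, h0⟩ u
      obtain ⟨L, c, hL⟩ := h2 x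
      have hL0 : L = 0 := e.ext fun i => by
        have := h i
        simpa [hL] using this
      simpa [hL, hL0] using h0
  rw [this]
  exact (forall_mem fun i => eq hSOC (h1 _) (h1 _)).and (nonneg hSOC (h1 _))

/-- The set of affine inequalities valid on a nonempty second-order cone representable set is
representable. -/
theorem polar (hSOC : ∀ m, 𝒦 (m + 1) (secondOrderCone m)) {ι : Type} [Fintype ι]
    {S : Set (ι → ℝ)} (h : IsSOCRepresentable S) (hne : S.Nonempty) :
    ConeRep 𝒦 {p : (ι → ℝ) × ℝ | ∀ y ∈ S, p.1 ⬝ᵥ y ≤ p.2} := by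
  obtain ⟨p, J, m, A, b, hS⟩ := h
  let W := (ι → ℝ) × (Fin p → ℝ)
  let f : ∀ j, W → Fin (m j + 1) → ℝ := fun j w => (A j).mulVec (Sum.elim w.1 w.2) - b j
  have hf : ∀ j, IsAff (f j) := fun j =>
    ((IsAff.id.fst.sumElim IsAff.id.snd).mulVec _).sub (IsAff.const _)
  let F : Set W := {w | ∀ j, f j w ∈ secondOrderCone (m j)}
  have hSF : ∀ y, y ∈ S ↔ ∃ v, (y, v) ∈ F := hS
  have hmid : ∀ j (w w' : W), f j (midpoint ℝ w w') = (1 / 2 : ℝ) • (f j w + f j w') := by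
    intro j w w'
    have e : midpoint ℝ w w' = w + (1 / 2 : ℝ) • (w' - w) := by
      rw [midpoint_eq_smul_add]; simp; module
    rw [e, (hf j).line]
    module
  have hFconv : Convex ℝ F := by
    intro x hx y hy s t hs ht hst j
    have e : s • x + t • y = x + t • (y - x) := by
      obtain rfl : s = 1 - t := by linarith
      module
    have e' : f j x + t • (f j y - f j x) = s • f j x + t • f j y := by
      obtain rfl : s = 1 - t := by linarith
      module
    rw [e, (hf j).line, e']
    exact convex_secondOrderCone _ (hx j) (hy j) hs ht hst
  have hFne : F.Nonempty := by
    obtain ⟨y, hy⟩ := hne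
    obtain ⟨v, hv⟩ := (hSF y).1 hy
    exact ⟨_, hv⟩
  -- `w₀` acts as a relative interior point of `F`: a constraint value there is interior, or
  -- nonzero, as soon as it is so anywhere on `F`.
  obtain ⟨w₀, hw₀, hQ⟩ := exists_forall_of_midpoint hFconv hFne
    (fun (i : Fin J × Bool) w => if i.2 then f i.1 w ∈ openSecondOrderCone (m i.1)
      else 0 < f i.1 w (Fin.last _)) (by
    rintro ⟨j, _ | _⟩ w hw w' hw' hq
    · simp only [Bool.false_eq_true, if_false] at hq ⊢
      rw [hmid]
      have := last_nonneg_of_mem (hw' j)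
      simp only [Pi.smul_apply, Pi.add_apply, smul_eq_mul]
      linarith
    · simp only [if_true] at hq ⊢
      rw [hmid, add_comm (f j w)]
      exact smul_mem_openSecondOrderCone (by norm_num) (add_mem_openSecondOrderCone (hw' j) hq))
  have hint : ∀ j, f j w₀ ∉ openSecondOrderCone (m j) → ∀ w ∈ F,
      f j w ∉ openSecondOrderCone (m j) := fun j hj w hw hw' =>
    hj (by simpa using hQ (j, true) ⟨w, hw, by simpa using hw'⟩)
  have hlast : ∀ j, ¬ 0 < f j w₀ (Fin.last _) → ∀ w ∈ F, ¬ 0 < f j w (Fin.last _) :=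
    fun j hj w hw hw' => hj (by simpa using hQ (j, false) ⟨w, hw, by simpa using hw'⟩)
  choose O T hOo hOc hOs hrO hrT hTO hLO hrep hpT using
    fun j => exists_open_cone_of_mem hSOC (hw₀ j)
  -- If `f j w + f j w₀` were interior, so would be the value at the midpoint of `w` and `w₀`,
  -- against the choice of `w₀`.
  have hFT : ∀ w ∈ F, ∀ j, f j w ∈ T j := fun w hw j => by
    refine hpT j _ (hw j) (fun hn hmem => ?_) (fun hn => hlast j hn w hw)
    refine hint j hn _ (hFconv.midpoint_mem hw hw₀) ?_
    rw [hmid]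
    exact smul_mem_openSecondOrderCone (by norm_num) hmem
  -- `y + s • f j w₀` lies in `O j` for every `s > 0`; let `s` tend to `0`.
  have hdual : ∀ j, ∀ z : Fin (m j + 1) → ℝ, (∀ y ∈ O j, 0 ≤ z ⬝ᵥ y) →
      ∀ y ∈ secondOrderCone (m j), 0 ≤ z ⬝ᵥ y := by
    intro j z hz y hy
    refine le_of_forall_pos_le_add fun δ hδ => ?_
    have hs : 0 < δ / (|z ⬝ᵥ f j w₀| + 1) := by positivity
    have := hz _ (hLO j y hy _ (hOs j _ hs _ (hrO j)))
    rw [dotProduct_add, dotProduct_smul, smul_eq_mul] at this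
    have h2 : δ / (|z ⬝ᵥ f j w₀| + 1) * (z ⬝ᵥ f j w₀) ≤ δ := by
      rw [div_mul_eq_mul_div, div_le_iff₀ (by positivity)]
      nlinarith [le_abs_self (z ⬝ᵥ f j w₀)]
    linarith
  choose Lf cf hLf using hf
  have hfadd : ∀ j w u, f j (w + u) = f j w + Lf j u := by
    intro j w u; rw [hLf, hLf, map_add]; abel
  -- Directions keeping every constraint value in its subspace `T j`. Hence `F ⊆ w₀ + V`, and `u =
  -- 0` is a Slater point for the cones `O j` on `V`.
  let V : Submodule ℝ W := ⨅ j, (T j).comap (Lf j)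
  have key : {q : (ι → ℝ) × ℝ | ∀ y ∈ S, q.1 ⬝ᵥ y ≤ q.2} =
      {q | ∃ z : ∀ j, Fin (m j + 1) → ℝ, (q, z) ∈ {x : ((ι → ℝ) × ℝ) × ∀ j, Fin (m j + 1) → ℝ |
        (∀ j, x ∈ {x | x.2 j ∈ {z | ∀ y ∈ O j, 0 ≤ z ⬝ᵥ y}}) ∧ ∀ u : V, 0 ≤
          (x.1.2 - x.1.1 ⬝ᵥ (w₀ + u.1).1) - ∑ j, x.2 j ⬝ᵥ f j (w₀ + u.1)}} := by
    ext q
    simp only [Set.mem_ofPred_eq]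
    constructor
    · intro hq
      have hfV : ∀ j, IsAff fun u : V => f j (w₀ + u.1) := fun j =>
        IsAff.comp ⟨Lf j, cf j, hLf j⟩ ((IsAff.const _).add (IsAff.of_linear V.subtype))
      have haV : IsAff fun u : V => q.2 - q.1 ⬝ᵥ (w₀ + u.1).1 :=
        (IsAff.const _).sub
          (((IsAff.const _).add (IsAff.of_linear V.subtype)).fst.const_dotProduct _)
      obtain ⟨z, hz, hza⟩ := exists_multipliers_of_slater hOo hOc hOs hfV haV (u₀ := 0)
        (fun j => by simpa using hrO j) (fun u hu => by
          rw [sub_nonneg]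
          refine hq _ ((hSF _).2 ⟨(w₀ + u.1).2, fun j => hTO j _ ?_ (hu j)⟩)
          have hu' := u.2
          rw [Submodule.mem_iInf] at hu'
          change f j (w₀ + u.1) ∈ T j
          rw [hfadd]
          exact (T j).add_mem (hrT j) (hu' j))
      exact ⟨z, hz, fun u => sub_nonneg.2 (hza u)⟩
    · rintro ⟨z, hz, hzu⟩ y hy
      obtain ⟨v, hv⟩ := (hSF y).1 hy
      have hmem : (y, v) - w₀ ∈ V := by
        rw [Submodule.mem_iInf]
        intro j
        have e : Lf j ((y, v) - w₀) = f j (y, v) - f j w₀ := by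
          rw [hLf, hLf, map_sub]; abel
        rw [Submodule.mem_comap, e]
        exact (T j).sub_mem (hFT _ hv j) (hrT j)
      have h1 := hzu ⟨_, hmem⟩
      simp only [add_sub_cancel] at h1
      have h2 : 0 ≤ ∑ j, z j ⬝ᵥ f j (y, v) :=
        Finset.sum_nonneg fun j _ => hdual j _ (hz j) _ (hv j)
      linarith
  rw [key]
  refine proj (and (forall_mem fun j => (hrep j).comap (IsAff.id.snd.apply j)) ?_)
  refine forall_nonneg hSOC (fun u => ?_) (fun x => ?_)
  · exact (IsAff.id.fst.snd.sub (IsAff.id.fst.fst.dotProduct_const _)).sub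
      (IsAff.sum _ fun j => (IsAff.id.snd.apply j).dotProduct_const _)
  · refine ((IsAff.const _).sub
          (((IsAff.const _).add (IsAff.of_linear V.subtype)).fst.const_dotProduct _)).sub
      (IsAff.sum _ fun j => IsAff.const_dotProduct (IsAff.comp ⟨Lf j, cf j, hLf j⟩
        ((IsAff.const _).add (IsAff.of_linear V.subtype))) _)

end ConeRep

/-! ### Norm bounds and Fenchel duality. -/

section Norm

variable {K : ℕ} (N : Seminorm ℝ (Fin K → ℝ))

theorem Seminorm.continuous_pi_real : Continuous N :=
  continuousOn_univ.1 (N.convexOn.continuousOn isOpen_univ)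

variable {N} (hN : ∀ y : Fin K → ℝ, N y = 0 → y = 0)
include hN

theorem exists_norm_le_mul_of_definite : ∃ B : ℝ, 0 ≤ B ∧ ∀ v : Fin K → ℝ, ‖v‖ ≤ B * N v := by
  by_cases hne : (Metric.sphere (0 : Fin K → ℝ) 1).Nonempty
  · obtain ⟨u, hu, hmin⟩ := (isCompact_sphere (0 : Fin K → ℝ) 1).exists_isMinOn hne
      N.continuous_pi_real.continuousOn
    have hu0 : 0 < N u := by
      refine lt_of_le_of_ne (apply_nonneg N u) fun h => ?_
      rw [hN u h.symm] at hu
      simp at hu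
    refine ⟨(N u)⁻¹, by positivity, fun v => ?_⟩
    by_cases hv : v = 0
    · simp [hv]
    have hv' : 0 < ‖v‖ := norm_pos_iff.2 hv
    have h1 : N u ≤ N (‖v‖⁻¹ • v) := hmin (by simp [norm_smul, hv'.ne'])
    rw [map_smul_eq_mul, norm_inv, norm_norm, le_inv_mul_iff₀ hv'] at h1
    rw [le_inv_mul_iff₀ hu0]
    linarith
  -- An empty unit sphere leaves only the zero vector.
  · refine ⟨0, le_rfl, fun v => ?_⟩
    by_contra hv
    push Not at hv
    have hv' : 0 < ‖v‖ := by simpa using hv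
    exact hne ⟨‖v‖⁻¹ • v, by simp [norm_smul, hv'.ne']⟩

theorem exists_dotProduct_le_mul (a : Fin K → ℝ) :
    ∃ L : ℝ, 0 ≤ L ∧ ∀ v, a ⬝ᵥ v ≤ L * N v := by
  obtain ⟨B, hB, h⟩ := exists_norm_le_mul_of_definite hN
  refine ⟨(∑ i, |a i|) * B, by positivity, fun v => ?_⟩
  calc a ⬝ᵥ v ≤ ∑ i, |a i| * ‖v‖ := Finset.sum_le_sum fun i _ =>
        (le_abs_self _).trans (by
          rw [abs_mul]
          exact mul_le_mul_of_nonneg_left (norm_le_pi_norm v i) (abs_nonneg _))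
    _ ≤ _ := by
      rw [← Finset.sum_mul, mul_assoc]
      exact mul_le_mul_of_nonneg_left (h v) (by positivity)

/-- Fenchel duality for a linear function penalized by a multiple of the norm. -/
theorem forall_sub_mul_norm_le_iff {S : Set (Fin K → ℝ)} (hS : Convex ℝ S) (hne : S.Nonempty)
    (g y₀ : Fin K → ℝ) {l : ℝ} (hl : 0 ≤ l) (s : ℝ) :
    (∀ y ∈ S, g ⬝ᵥ y - l * N (y - y₀) ≤ s) ↔
      ∃ ρ : Fin K → ℝ, (∀ v, N v ≤ 1 → ρ ⬝ᵥ v ≤ l) ∧ ∀ y ∈ S, (g - ρ) ⬝ᵥ y ≤ s - ρ ⬝ᵥ y₀ := by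
  constructor
  · intro h
    have hA : Convex ℝ {p : (Fin K → ℝ) × ℝ | l * N (p.1 - y₀) < p.2} := by
      intro p hp q hq a b ha hb hab
      simp only [Set.mem_ofPred_eq] at hp hq ⊢
      have e : (a • p + b • q).1 - y₀ = a • (p.1 - y₀) + b • (q.1 - y₀) := by
        obtain rfl : a = 1 - b := by linarith
        simp; module
      have h1 : N ((a • p + b • q).1 - y₀) ≤ a * N (p.1 - y₀) + b * N (q.1 - y₀) := by
        rw [e]
        refine (map_add_le_add N _ _).trans_eq ?_
        rw [map_smul_eq_mul, map_smul_eq_mul, Real.norm_of_nonneg ha, Real.norm_of_nonneg hb]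
      have h2 := mul_le_mul_of_nonneg_left h1 hl
      have h3 : a * (l * N (p.1 - y₀)) + b * (l * N (q.1 - y₀)) < a * p.2 + b * q.2 := by
        rcases ha.eq_or_lt with rfl | ha
        · obtain rfl : b = 1 := by linarith
          simpa using hq
        · exact add_lt_add_of_lt_of_le (mul_lt_mul_of_pos_left hp ha)
            (mul_le_mul_of_nonneg_left hq.le hb)
      simp only [Prod.snd_add, Prod.smul_snd, smul_eq_mul]
      linarith
    have hAo : IsOpen {p : (Fin K → ℝ) × ℝ | l * N (p.1 - y₀) < p.2} :=
      isOpen_lt (continuous_const.mul (N.continuous_pi_real.comp (by fun_prop))) continuous_snd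
    have hB : Convex ℝ {p : (Fin K → ℝ) × ℝ | p.1 ∈ S ∧ p.2 ≤ g ⬝ᵥ p.1 - s} := by
      intro p hp q hq a b ha hb hab
      refine ⟨hS hp.1 hq.1 ha hb hab, ?_⟩
      simp only [Prod.snd_add, Prod.smul_snd, Prod.fst_add, Prod.smul_fst, smul_eq_mul,
        dotProduct_add, dotProduct_smul]
      have := mul_le_mul_of_nonneg_left hp.2 ha
      have := mul_le_mul_of_nonneg_left hq.2 hb
      obtain rfl : a = 1 - b := by linarith
      linarith
    -- Separates the strict epigraph of `l * N (· - y₀)` from the hypograph of `g ⬝ᵥ · - s` over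
    -- `S`. The separating slope, normalized by `-α > 0`, is `ρ`.
    obtain ⟨φ, c, hφA, hφB⟩ := geometric_hahn_banach_open hA hAo hB (by
      rw [Set.disjoint_left]
      rintro p hp ⟨hpS, hp2⟩
      have := h _ hpS
      simp only [Set.mem_ofPred_eq] at hp
      linarith)
    let z : Fin K → ℝ := fun i => φ (Pi.single i 1, 0)
    set α := φ (0, 1) with hα
    have hφ : ∀ v t, φ (v, t) = z ⬝ᵥ v + t * α := by
      intro v t
      have e : (v, t) = ContinuousLinearMap.inl ℝ (Fin K → ℝ) ℝ v + t • ((0 : Fin K → ℝ), (1 : ℝ)) := by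
        ext <;> simp
      rw [e, map_add, map_smul, smul_eq_mul]
      congr 1
      conv_lhs => rw [pi_eq_sum_univ' v]
      simp only [map_sum, map_smul, smul_eq_mul, ContinuousLinearMap.inl_apply, z, dotProduct,
        mul_comm]
    have hA' : ∀ v t, l * N (v - y₀) < t → z ⬝ᵥ v + t * α < c := fun v t ht => by
      rw [← hφ]; exact hφA (v, t) ht
    have hB' : ∀ y ∈ S, ∀ t, t ≤ g ⬝ᵥ y - s → c ≤ z ⬝ᵥ y + t * α := fun y hy t ht => by
      rw [← hφ]; exact hφB (y, t) ⟨hy, ht⟩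
    have hαneg : α < 0 := by
      by_contra hα0
      push Not at hα0
      obtain ⟨y, hy⟩ := hne
      have h1 := hB' y hy _ le_rfl
      have h2 := hA' y (max (l * N (y - y₀) + 1) (g ⬝ᵥ y - s))
        (lt_of_lt_of_le (by linarith) (le_max_left _ _))
      have h3 := mul_le_mul_of_nonneg_right
        (le_max_right (l * N (y - y₀) + 1) (g ⬝ᵥ y - s)) hα0
      linarith
    have hA2 : ∀ v, z ⬝ᵥ v + l * N (v - y₀) * α ≤ c := by
      intro v
      refine le_of_forall_pos_le_add fun δ hδ => ?_
      have := hA' v (l * N (v - y₀) + δ / -α) (by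
        have : 0 < δ / -α := div_pos hδ (by linarith)
        linarith)
      have e : δ / -α * α = -δ := by have := hαneg.ne; field_simp
      rw [add_mul, e] at this
      linarith
    have hinv : 0 < (-α)⁻¹ := inv_pos.2 (by linarith)
    refine ⟨(-α)⁻¹ • z, fun v hv => ?_, fun y hy => ?_⟩
    · rw [smul_dotProduct, smul_eq_mul, inv_mul_le_iff₀ (by linarith)]
      by_contra hcon
      push Not at hcon
      have hd : 0 < z ⬝ᵥ v + l * α := by linarith
      -- Moving from `y₀` by a large multiple of a `v` violating the dual norm bound breaks `hA2`.
      set R := (|c - z ⬝ᵥ y₀| + 1) / (z ⬝ᵥ v + l * α) with hR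
      have hRpos : 0 < R := by positivity
      have h1 := hA2 (y₀ + R • v)
      rw [add_sub_cancel_left, map_smul_eq_mul, Real.norm_of_nonneg hRpos.le, dotProduct_add,
        dotProduct_smul, smul_eq_mul] at h1
      have h2 : R * (z ⬝ᵥ v + l * α) = |c - z ⬝ᵥ y₀| + 1 := by rw [hR]; field_simp
      have h3 : l * (R * N v) ≤ l * R := by
        have := mul_le_mul_of_nonneg_left (mul_le_of_le_one_right hRpos.le hv) hl
        linarith
      have h4 := mul_le_mul_of_nonpos_right h3 hαneg.le
      linarith [le_abs_self (c - z ⬝ᵥ y₀)]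
    · have h1 := hB' y hy _ le_rfl
      have h2 := hA2 y₀
      simp only [sub_self, map_zero, mul_zero, zero_mul, add_zero] at h2
      rw [sub_dotProduct, smul_dotProduct, smul_dotProduct, smul_eq_mul, smul_eq_mul]
      rw [← mul_le_mul_iff_right₀ (neg_pos.2 hαneg)]
      have hne' : -α ≠ 0 := by linarith
      simp only [mul_sub, mul_inv_cancel_left₀ hne']
      linarith
  · rintro ⟨ρ, hρ, h⟩ y hy
    have h1 : ρ ⬝ᵥ (y - y₀) ≤ l * N (y - y₀) := by
      by_cases h0 : N (y - y₀) = 0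
      · rw [hN _ h0]; simp
      · have hpos : 0 < N (y - y₀) := lt_of_le_of_ne (apply_nonneg N _) (Ne.symm h0)
        have := hρ ((N (y - y₀))⁻¹ • (y - y₀)) (by
          rw [map_smul_eq_mul, norm_inv, Real.norm_of_nonneg hpos.le, inv_mul_cancel₀ h0])
        rw [dotProduct_smul, smul_eq_mul, inv_mul_le_iff₀ hpos] at this
        linarith
    have h2 := h y hy
    rw [dotProduct_sub] at h1
    rw [sub_dotProduct] at h2
    linarith

end Norm

theorem IsSOCRepresentable.convex {ι : Type} [Fintype ι] {S : Set (ι → ℝ)}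
    (h : IsSOCRepresentable S) : Convex ℝ S := by
  obtain ⟨p, J, m, A, b, h⟩ := h
  intro x hx y hy s t hs ht hst
  rw [h] at *
  obtain ⟨v, hv⟩ := hx
  obtain ⟨w, hw⟩ := hy
  refine ⟨s • v + t • w, fun j => ?_⟩
  have e : (A j).mulVec (Sum.elim (s • x + t • y) (s • v + t • w)) - b j =
      s • ((A j).mulVec (Sum.elim x v) - b j) + t • ((A j).mulVec (Sum.elim y w) - b j) := by
    have e1 : Sum.elim (s • x + t • y) (s • v + t • w) = s • Sum.elim x v + t • Sum.elim y w := by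
      ext i; cases i <;> simp
    rw [e1, Matrix.mulVec_add, Matrix.mulVec_smul, Matrix.mulVec_smul]
    obtain rfl : s = 1 - t := by linarith
    module
  rw [e]
  exact convex_secondOrderCone _ (hv j) (hw j) hs ht hst

/-- A projection of a closed set may fail to be closed, but in finite dimension it is σ-compact,
hence Borel. -/
theorem IsSOCRepresentable.measurableSet {ι : Type} [Fintype ι] {S : Set (ι → ℝ)}
    (h : IsSOCRepresentable S) : MeasurableSet S := by
  obtain ⟨p, J, m, A, b, h⟩ := h
  have e : S = Prod.fst '' {w : (ι → ℝ) × (Fin p → ℝ) |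
      ∀ j, (A j).mulVec (Sum.elim w.1 w.2) - b j ∈ secondOrderCone (m j)} := by
    ext y; simp [h]
  have hcl : IsClosed {w : (ι → ℝ) × (Fin p → ℝ) |
      ∀ j, (A j).mulVec (Sum.elim w.1 w.2) - b j ∈ secondOrderCone (m j)} := by
    simp only [Set.ofPred_forall]
    refine isClosed_iInter fun j => (isClosed_secondOrderCone (m j)).preimage ?_
    refine Continuous.sub (Continuous.matrix_mulVec continuous_const ?_) continuous_const
    refine continuous_pi fun i => ?_
    cases i <;> simp <;> fun_prop
  have hσ : IsSigmaCompact S := by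
    rw [e]
    exact (isSigmaCompact_univ.of_isClosed_subset hcl (Set.subset_univ _)).image continuous_fst
  obtain ⟨C, hC, rfl⟩ := hσ
  exact MeasurableSet.iUnion fun n => (hC n).measurableSet

/-- Fenchel duality turns the penalty into a dual norm constraint on `ρ`; the remaining affine
inequality on `S` is handled by `polar`. -/
theorem ConeRep.penalized {𝒦 : ∀ m : ℕ, Set (Fin m → ℝ) → Prop}
    (hSOC : ∀ m, 𝒦 (m + 1) (secondOrderCone m)) {K : ℕ} {N : Seminorm ℝ (Fin K → ℝ)}
    (hN : ∀ y : Fin K → ℝ, N y = 0 → y = 0) (hdual : 𝒦 (K + 1) (dualNormCone N))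
    {S : Set (Fin K → ℝ)} (hS : IsSOCRepresentable S) (hne : S.Nonempty) (y₀ : Fin K → ℝ) :
    ConeRep 𝒦 {p : (Fin K → ℝ) × ℝ × ℝ |
      0 ≤ p.2.1 ∧ ∀ y ∈ S, p.1 ⬝ᵥ y - p.2.1 * N (y - y₀) ≤ p.2.2} := by
  have key : {p : (Fin K → ℝ) × ℝ × ℝ |
      0 ≤ p.2.1 ∧ ∀ y ∈ S, p.1 ⬝ᵥ y - p.2.1 * N (y - y₀) ≤ p.2.2} =
      {p | 0 ≤ p.2.1 ∧ ∃ ρ : Fin K → ℝ, (p, ρ) ∈ {x : ((Fin K → ℝ) × ℝ × ℝ) × (Fin K → ℝ) |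
        (Fin.snoc x.2 x.1.2.1 : Fin (K + 1) → ℝ) ∈ dualNormCone N ∧
        (x.1.1 - x.2, x.1.2.2 - x.2 ⬝ᵥ y₀) ∈
          {q : (Fin K → ℝ) × ℝ | ∀ y ∈ S, q.1 ⬝ᵥ y ≤ q.2}}} := by
    ext p
    refine and_congr_right fun hl => ?_
    rw [forall_sub_mul_norm_le_iff hN hS.convex hne _ _ hl]
    simp [dualNormCone]
  rw [key]
  refine (nonneg hSOC IsAff.id.snd.fst).and (proj (and ?_ ?_))
  · refine (of_cone hdual).comap (IsAff.pi fun i => ?_)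
    refine Fin.lastCases ?_ (fun i => ?_) i
    · simpa using IsAff.id.fst.snd.fst
    · simpa using IsAff.id.snd.apply i
  · exact (polar hSOC hS hne).comap ((IsAff.id.fst.fst.sub IsAff.id.snd).prodMk
      (IsAff.id.fst.snd.snd.sub (IsAff.id.snd.dotProduct_const y₀)))

/-! ### Value functions of linear programs. -/

/-- Fourier–Motzkin elimination of one variable. -/
theorem exists_eliminate_one {E : Type*} [AddCommGroup E] [Module ℝ E] {n : ℕ}
    (a : Fin n → E × ℝ →ₗ[ℝ] ℝ) :
    ∃ (n' : ℕ) (a' : Fin n' → E →ₗ[ℝ] ℝ), ∀ x,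
      (∃ t, ∀ i, 0 ≤ a i (x, t)) ↔ ∀ i, 0 ≤ a' i x := by
  classical
  let α : Fin n → E →ₗ[ℝ] ℝ := fun i => a i ∘ₗ LinearMap.inl ℝ E ℝ
  let β : Fin n → ℝ := fun i => a i (0, 1)
  have ha : ∀ i x t, a i (x, t) = α i x + t * β i := by
    intro i x t
    have e : (x, t) = LinearMap.inl ℝ E ℝ x + t • ((0 : E), (1 : ℝ)) := by ext <;> simp
    rw [e, map_add, map_smul]; rfl
  -- Constraints free of `t` survive; each lower bound on `t` is paired with each upper bound.
  let I := {i // β i = 0} ⊕ {i // 0 < β i} × {i // β i < 0}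
  let e := (Fintype.equivFin I).symm
  let a' : I → E →ₗ[ℝ] ℝ := Sum.elim (fun i => α i.1)
    (fun p => β p.1.1 • α p.2.1 - β p.2.1 • α p.1.1)
  refine ⟨Fintype.card I, fun i => a' (e i), fun x => ?_⟩
  have he : (∀ i, 0 ≤ a' (e i) x) ↔ ∀ i, 0 ≤ a' i x := e.forall_congr_right (q := fun i => 0 ≤ a' i x)
  rw [he]
  simp only [ha]
  constructor
  · rintro ⟨t, ht⟩ (⟨i, hi⟩ | ⟨⟨i, hi⟩, ⟨j, hj⟩⟩)
    · simpa [a', hi] using ht i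
    · have h1 := mul_nonneg hi.le (ht j)
      have h2 := mul_nonneg (neg_nonneg.2 hj.le) (ht i)
      simp only [a', Sum.elim_inr, LinearMap.sub_apply, LinearMap.smul_apply, smul_eq_mul]
      linarith
  · intro h
    have h0 : ∀ i, β i = 0 → 0 ≤ α i x := fun i hi => h (Sum.inl ⟨i, hi⟩)
    have hpn : ∀ i j, 0 < β i → β j < 0 → -α i x / β i ≤ α j x / -β j := by
      intro i j hi hj
      have := h (Sum.inr (⟨i, hi⟩, ⟨j, hj⟩))
      simp only [a', Sum.elim_inr, LinearMap.sub_apply, LinearMap.smul_apply, smul_eq_mul] at this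
      rw [div_le_div_iff₀ hi (by linarith)]
      linarith
    obtain ⟨t, ht1, ht2⟩ : ∃ t, (∀ i, 0 < β i → -α i x / β i ≤ t) ∧
        ∀ j, β j < 0 → t ≤ α j x / -β j := by
      by_cases hne : Nonempty {i // 0 < β i}
      · obtain ⟨i₀, hi₀⟩ := Finite.exists_max fun i : {i // 0 < β i} => -α i x / β i
        exact ⟨_, fun i hi => hi₀ ⟨i, hi⟩, fun j hj => hpn _ _ i₀.2 hj⟩
      · obtain ⟨t, ht⟩ := (Set.finite_range fun j => α j x / -β j).bddBelow
        exact ⟨t, fun i hi => absurd ⟨⟨i, hi⟩⟩ hne, fun j _ => ht ⟨j, rfl⟩⟩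
    refine ⟨t, fun i => ?_⟩
    rcases lt_trichotomy (β i) 0 with hi | hi | hi
    · have := ht2 i hi
      rw [le_div_iff₀ (by linarith)] at this
      linarith
    · simpa [hi] using h0 i hi
    · have := ht1 i hi
      rw [div_le_iff₀ hi] at this
      linarith

/-- The projection of a polyhedral cone is a polyhedral cone. -/
theorem exists_eliminate {s : ℕ} {E : Type*} [AddCommGroup E] [Module ℝ E] {n : ℕ}
    (a : Fin n → E × (Fin s → ℝ) →ₗ[ℝ] ℝ) :
    ∃ (n' : ℕ) (a' : Fin n' → E →ₗ[ℝ] ℝ), ∀ x,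
      (∃ γ, ∀ i, 0 ≤ a i (x, γ)) ↔ ∀ i, 0 ≤ a' i x := by
  induction s generalizing n with
  | zero =>
    refine ⟨n, fun i => a i ∘ₗ LinearMap.inl ℝ E _, fun x => ⟨?_, fun h => ⟨0, h⟩⟩⟩
    rintro ⟨γ, h⟩ i
    rw [Subsingleton.elim γ 0] at h
    exact h i
  | succ s ih =>
    let c : (E × (Fin s → ℝ)) × ℝ →ₗ[ℝ] E × (Fin (s + 1) → ℝ) :=
      { toFun := fun p => (p.1.1, Fin.cons p.2 p.1.2)
        map_add' := fun p q => by
          ext i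
          · rfl
          · refine Fin.cases ?_ (fun i => ?_) i <;> simp
        map_smul' := fun r p => by
          ext i
          · rfl
          · refine Fin.cases ?_ (fun i => ?_) i <;> simp }
    obtain ⟨n₁, a₁, h₁⟩ := exists_eliminate_one fun i => a i ∘ₗ c
    obtain ⟨n₂, a₂, h₂⟩ := ih a₁
    refine ⟨n₂, a₂, fun x => ?_⟩
    rw [← h₂]
    simp only [← h₁]
    constructor
    · rintro ⟨γ, h⟩
      refine ⟨Fin.tail γ, γ 0, fun i => ?_⟩
      simpa [c, Fin.cons_self_tail] using h i
    · rintro ⟨γ, t, h⟩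
      exact ⟨_, h⟩

/-- The optimal value of a linear program in standard form, as a function of the right-hand side,
is a maximum of finitely many linear functions. -/
theorem exists_max_linear_of_linearProgram {r s : ℕ} (q : Fin s → ℝ)
    (W : Matrix (Fin r) (Fin s) ℝ) :
    ∃ (I : Type) (_ : Fintype I) (l : I → (Fin r → ℝ) →ₗ[ℝ] ℝ), ∀ (b : Fin r → ℝ) (v : ℝ),
      IsLeast {t : ℝ | ∃ γ : Fin s → ℝ, (∀ i, 0 ≤ γ i) ∧ W.mulVec γ = b ∧ t = q ⬝ᵥ γ} v →
        (∀ i, l i b ≤ v) ∧ ∃ i, v = l i b := by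
  classical
  let P := ((Fin r → ℝ) × ℝ) × (Fin s → ℝ)
  let pγ : P →ₗ[ℝ] Fin s → ℝ := LinearMap.snd ℝ _ _
  let pb : P →ₗ[ℝ] Fin r → ℝ := LinearMap.fst ℝ _ _ ∘ₗ LinearMap.fst ℝ _ _
  let pt : P →ₗ[ℝ] ℝ := LinearMap.snd ℝ _ _ ∘ₗ LinearMap.fst ℝ _ _
  let D : P →ₗ[ℝ] Fin r → ℝ := W.mulVecLin ∘ₗ pγ - pb
  let J := Fin s ⊕ (Fin r ⊕ Fin r) ⊕ Unit
  let a : J → P →ₗ[ℝ] ℝ := Sum.elim (fun i => LinearMap.proj i ∘ₗ pγ)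
    (Sum.elim (Sum.elim (fun i => LinearMap.proj i ∘ₗ D) (fun i => -(LinearMap.proj i ∘ₗ D)))
      (fun _ => pt - (dotProductBilin ℝ ℝ q) ∘ₗ pγ))
  let e := (Fintype.equivFin J).symm
  have hfeas : ∀ b t γ, (∀ i, 0 ≤ a (e i) ((b, t), γ)) ↔
      (∀ i, 0 ≤ γ i) ∧ W.mulVec γ = b ∧ q ⬝ᵥ γ ≤ t := by
    intro b t γ
    rw [e.forall_congr_right (q := fun i => 0 ≤ a i ((b, t), γ))]
    simp only [J, Sum.forall, a, Sum.elim_inl, Sum.elim_inr, forall_const]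
    refine and_congr Iff.rfl (and_congr ?_ ?_)
    · rw [funext_iff, ← forall_and]
      refine forall_congr' fun i => ?_
      change 0 ≤ W.mulVec γ i - b i ∧ 0 ≤ -(W.mulVec γ i - b i) ↔ _
      constructor
      · rintro ⟨h1, h2⟩; linarith
      · intro h; rw [h]; simp
    · exact sub_nonneg
  -- Eliminating `γ` leaves the epigraph of the value function; the rows with positive coefficient
  -- of `t` are the affine minorants sought.
  obtain ⟨n', a', ha'⟩ := exists_eliminate fun i => a (e i)
  simp only [Prod.forall, hfeas] at ha'
  let A : Fin n' → (Fin r → ℝ) →ₗ[ℝ] ℝ := fun i => a' i ∘ₗ LinearMap.inl ℝ _ ℝ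
  let κ : Fin n' → ℝ := fun i => a' i (0, 1)
  have hA : ∀ i b t, a' i (b, t) = A i b + t * κ i := by
    intro i b t
    have e : (b, t) = LinearMap.inl ℝ (Fin r → ℝ) ℝ b + t • ((0 : Fin r → ℝ), (1 : ℝ)) := by
      ext <;> simp
    rw [e, map_add, map_smul]; rfl
  simp only [hA] at ha'
  refine ⟨{i // 0 < κ i}, inferInstance, fun i => -((κ i)⁻¹ • A i), fun b v hv => ?_⟩
  obtain ⟨⟨γ, hγ, hb, hvγ⟩, hmin⟩ := hv
  have hbv := (ha' b v).1 ⟨γ, hγ, hb, hvγ.ge⟩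
  have hl : ∀ (i : {i // 0 < κ i}) (t : ℝ), (-((κ i)⁻¹ • A i)) b ≤ t ↔ 0 ≤ A i b + t * κ i := by
    intro i t
    rw [LinearMap.neg_apply, LinearMap.smul_apply, smul_eq_mul, neg_le_iff_add_nonneg,
      ← mul_le_mul_iff_right₀ i.2, mul_zero, mul_add, mul_inv_cancel_left₀ i.2.ne', add_comm,
      mul_comm t, add_comm]
  refine ⟨fun i => (hl i v).2 (hbv i), ?_⟩
  by_contra! hne
  -- If no minorant is tight, `t` can drop below `v`; rows with `κ i ≤ 0` only gain from this.
  have hlow : ∃ t < v, ∀ i : {i // 0 < κ i}, (-((κ i)⁻¹ • A i)) b ≤ t := by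
    by_cases hI : Nonempty {i // 0 < κ i}
    · obtain ⟨i₀, hi₀⟩ := Finite.exists_max fun i : {i // 0 < κ i} => (-((κ i)⁻¹ • A i)) b
      exact ⟨_, lt_of_le_of_ne ((hl i₀ v).2 (hbv i₀)) (hne i₀).symm, hi₀⟩
    · exact ⟨v - 1, by linarith, fun i => absurd ⟨i⟩ hI⟩
  obtain ⟨t, htv, ht⟩ := hlow
  obtain ⟨γ', h1, h2, h3⟩ := (ha' b t).2 fun i => by
    by_cases hi : 0 < κ i
    · exact (hl ⟨i, hi⟩ t).1 (ht ⟨i, hi⟩)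
    · have := hbv i
      have := mul_le_mul_of_nonpos_right htv.le (not_lt.1 hi)
      linarith
  have := hmin ⟨γ', h1, h2, rfl⟩
  linarith

/-! ### Both cost models as maxima of affine functions. -/

/-- The cost `c x` is on `Ξ` a maximum of finitely many affine functions, whose coefficients
`d` satisfy `(x, d) ∈ R` for a representable set `R` all of whose members give an upper bound. -/
def IsMaxAffineCost (𝒦 : ∀ m : ℕ, Set (Fin m → ℝ) → Prop) {ι : Type} [Fintype ι] {K : ℕ}
    (X : Set (ι → ℝ)) (Ξ : Set (Fin K → ℝ)) (c : (ι → ℝ) → (Fin K → ℝ) → ℝ) : Prop :=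
  ∃ (I : Type) (_ : Fintype I) (R : Set ((ι → ℝ) × (I → (Fin K → ℝ) × ℝ))), ConeRep 𝒦 R ∧
    (∀ x ∈ X, ∃ d, (x, d) ∈ R ∧ ∀ y ∈ Ξ, (∀ i, (d i).1 ⬝ᵥ y + (d i).2 ≤ c x y) ∧
      ∃ i, c x y = (d i).1 ⬝ᵥ y + (d i).2) ∧
    ∀ x ∈ X, ∀ d, (x, d) ∈ R → ∀ y ∈ Ξ, ∃ i, c x y ≤ (d i).1 ⬝ᵥ y + (d i).2

/-- One piece suffices. As `y ≥ 0`, raising its slopes above `c_k(x)` only raises the value, so `R`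
is built from the epigraphs. -/
theorem IsSingleStageCost.isMaxAffineCost {𝒦 : ∀ m : ℕ, Set (Fin m → ℝ) → Prop}
    (hSOC : ∀ m, 𝒦 (m + 1) (secondOrderCone m)) {ι : Type} [Fintype ι] {K : ℕ}
    {X : Set (ι → ℝ)} {Ξ : Set (Fin K → ℝ)} {c : (ι → ℝ) → (Fin K → ℝ) → ℝ}
    (h : IsSingleStageCost X Ξ c) : IsMaxAffineCost 𝒦 X Ξ c := by
  obtain ⟨hΞ, D, ck, hD, hc⟩ := h
  refine ⟨Unit, inferInstance, {p | (∀ k, p ∈ {p : (ι → ℝ) × (Unit → (Fin K → ℝ) × ℝ) |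
    (Sum.elim p.1 (fun _ => (p.2 ()).1 k) : ι ⊕ Fin 1 → ℝ) ∈ {p : ι ⊕ Fin 1 → ℝ |
        (fun i => p (Sum.inl i)) ∈ D k ∧ ck k (fun i => p (Sum.inl i)) ≤ p (Sum.inr 0)}}) ∧
      (p.2 ()).2 = 0}, ?_, fun x hx => ?_, fun x hx d hd y hy => ?_⟩
  · exact (ConeRep.forall_mem fun k => (ConeRep.of_isSOCRepresentable hSOC (hD k).2).comap
      (IsAff.id.fst.sumElim (IsAff.pi fun _ => ((IsAff.id.snd.apply ()).fst.apply k)))).and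
      (ConeRep.eq hSOC (IsAff.id.snd.apply ()).snd (IsAff.const 0))
  · refine ⟨fun _ => (fun k => ck k x, 0), ⟨fun k => ⟨(hD k).1 hx, le_rfl⟩, rfl⟩, fun y hy => ?_⟩
    rw [hc x hx y hy]
    exact ⟨fun _ => by simp [dotProduct], (), by simp [dotProduct]⟩
  · refine ⟨(), ?_⟩
    rw [hc x hx y hy, hd.2, add_zero]
    exact Finset.sum_le_sum fun k _ => mul_le_mul_of_nonneg_right (hd.1 k).2 (hΞ y hy k)

/-- The right-hand side `h(y) - T(y)x` is affine in `x` and in `y` separately, so each linear piece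
of the value function has coefficients affine in `x`, and `R` is their graph. -/
theorem IsTwoStageCost.isMaxAffineCost {𝒦 : ∀ m : ℕ, Set (Fin m → ℝ) → Prop}
    (hSOC : ∀ m, 𝒦 (m + 1) (secondOrderCone m)) {ι : Type} [Fintype ι] {K : ℕ}
    {X : Set (ι → ℝ)} {Ξ : Set (Fin K → ℝ)} {c : (ι → ℝ) → (Fin K → ℝ) → ℝ}
    (h : IsTwoStageCost X Ξ c) : IsMaxAffineCost 𝒦 X Ξ c := by
  obtain ⟨r, s, q, W, T₀, T, h₀, h, hc⟩ := h
  obtain ⟨I, _, l, hl⟩ := exists_max_linear_of_linearProgram q W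
  have hval : ∀ x ∈ X, ∀ y ∈ Ξ, (∀ i, (fun k => l i (h k - (T k).mulVec x)) ⬝ᵥ y +
      l i (h₀ - T₀.mulVec x) ≤ c x y) ∧ ∃ i, c x y =
        (fun k => l i (h k - (T k).mulVec x)) ⬝ᵥ y + l i (h₀ - T₀.mulVec x) := by
    intro x hx y hy
    have e : ∀ i, (fun k => l i (h k - (T k).mulVec x)) ⬝ᵥ y + l i (h₀ - T₀.mulVec x) =
        l i (h₀ + ∑ k, y k • h k - (T₀ + ∑ k, y k • T k).mulVec x) := by
      intro i
      have : h₀ + ∑ k, y k • h k - (T₀ + ∑ k, y k • T k).mulVec x =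
          (h₀ - T₀.mulVec x) + ∑ k, y k • (h k - (T k).mulVec x) := by
        rw [Matrix.add_mulVec, Matrix.sum_mulVec]
        simp only [Matrix.smul_mulVec, smul_sub, Finset.sum_sub_distrib]
        abel
      rw [this, map_add, map_sum, add_comm]
      simp [dotProduct, mul_comm]
    simp only [e]
    refine hl _ _ ?_
    convert hc x hx y hy using 5 with t γ
    rw [eq_sub_iff_add_eq, add_comm]
  refine ⟨I, inferInstance, {p | ∀ i, p ∈ {p : (ι → ℝ) × (I → (Fin K → ℝ) × ℝ) |
    (∀ k, p ∈ {p : (ι → ℝ) × (I → (Fin K → ℝ) × ℝ) |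
      (p.2 i).1 k = l i (h k - (T k).mulVec p.1)}) ∧ (p.2 i).2 = l i (h₀ - T₀.mulVec p.1)}},
    ?_, fun x hx => ⟨fun i => (fun k => l i (h k - (T k).mulVec x), l i (h₀ - T₀.mulVec x)),
      fun i => ⟨fun k => rfl, rfl⟩, hval x hx⟩, fun x hx d hd y hy => ?_⟩
  · refine ConeRep.forall_mem fun i => (ConeRep.forall_mem fun k =>
      ConeRep.eq hSOC ((IsAff.id.snd.apply i).fst.apply k) ?_).and
      (ConeRep.eq hSOC (IsAff.id.snd.apply i).snd ?_)
    · exact (IsAff.of_linear (l i)).comp ((IsAff.const _).sub (IsAff.id.fst.mulVec _))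
    · exact (IsAff.of_linear (l i)).comp ((IsAff.const _).sub (IsAff.id.fst.mulVec _))
  · obtain ⟨i, hi⟩ := (hval x hx y hy).2
    refine ⟨i, hi.le.trans ?_⟩
    have h1 : (d i).1 = fun k => l i (h k - (T k).mulVec x) := funext (hd i).1
    rw [h1, (hd i).2]

/-! ### Wasserstein duality. -/

/-- Lagrangian duality with one constraint: for a convex set `D` of pairs (resource, reward), the
reward under a resource bound `ε` is bounded by a linear penalization. -/
theorem exists_penalty_of_convex {D : Set (ℝ × ℝ)} (hD : Convex ℝ D) {s₀ L ε F : ℝ}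
    (hs₀ : (0, s₀) ∈ D) (hL0 : 0 ≤ L)
    (hL : ∀ p ∈ D, p.2 ≤ s₀ + L * p.1) (hε : 0 ≤ ε) (hF : ∀ p ∈ D, p.1 ≤ ε → p.2 ≤ F) :
    ∃ l, 0 ≤ l ∧ ∀ p ∈ D, p.2 - l * p.1 ≤ F - l * ε := by
  -- At `ε = 0` there is no Slater point, and the linear growth bound `L` serves as multiplier.
  rcases hε.eq_or_lt with rfl | hε
  · refine ⟨L, hL0, fun p hp => ?_⟩
    have := hL p hp
    have := hF _ hs₀ le_rfl
    simp only at this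
    linarith
  have hs : s₀ ≤ F := hF _ hs₀ hε.le
  have cross : ∀ p ∈ D, ε < p.1 → ∀ p' ∈ D, p'.1 < ε →
      (p.2 - F) / (p.1 - ε) ≤ (F - p'.2) / (ε - p'.1) := by
    intro p hp h p' hp' h'
    rw [div_le_div_iff₀ (by linarith) (by linarith)]
    have hd : 0 < p.1 - p'.1 := by linarith
    have hmem := hD hp' hp (a := (p.1 - ε) / (p.1 - p'.1)) (b := (ε - p'.1) / (p.1 - p'.1))
      (div_nonneg (by linarith) hd.le) (div_nonneg (by linarith) hd.le) (by field_simp; ring)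
    -- The convex combination has resource exactly `ε`.
    have h1 := hF _ hmem (by
      simp only [Prod.fst_add, Prod.smul_fst, smul_eq_mul]
      apply le_of_eq
      field_simp
      ring)
    simp only [Prod.snd_add, Prod.smul_snd, smul_eq_mul] at h1
    have e : (p.1 - ε) / (p.1 - p'.1) * p'.2 + (ε - p'.1) / (p.1 - p'.1) * p.2 =
        ((p.1 - ε) * p'.2 + (ε - p'.1) * p.2) / (p.1 - p'.1) := by field_simp
    rw [e, div_le_iff₀ hd] at h1
    linarith
  -- The multiplier is the largest chord slope to the right of `ε`; inserting `0` makes it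
  -- nonnegative and keeps the set nonempty.
  let S : Set ℝ := insert 0 ((fun p : ℝ × ℝ => (p.2 - F) / (p.1 - ε)) '' {p ∈ D | ε < p.1})
  have hS : ∀ p' ∈ D, p'.1 < ε → ∀ a ∈ S, a ≤ (F - p'.2) / (ε - p'.1) := by
    rintro p' hp' h' a (rfl | ⟨p, ⟨hp, h⟩, rfl⟩)
    · exact div_nonneg (by linarith [hF p' hp' h'.le]) (by linarith)
    · exact cross p hp h p' hp' h'
  have hbdd : BddAbove S := ⟨_, hS _ hs₀ hε⟩
  refine ⟨sSup S, le_csSup hbdd (Set.mem_insert _ _), fun p hp => ?_⟩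
  rcases lt_trichotomy p.1 ε with h | h | h
  · have := csSup_le ⟨0, Set.mem_insert _ _⟩ (hS p hp h)
    rw [le_div_iff₀ (by linarith)] at this
    linarith
  · have := hF p hp h.le
    rw [h]; linarith
  · have : (p.2 - F) / (p.1 - ε) ≤ sSup S :=
      le_csSup hbdd (Set.mem_insert_of_mem _ ⟨p, ⟨hp, h⟩, rfl⟩)
    rw [div_le_iff₀ (by linarith)] at this
    linarith

section Wasserstein

variable {K M : ℕ} {N : Seminorm ℝ (Fin K → ℝ)} {Ξ : Set (Fin K → ℝ)}
  {y : Fin M → Fin K → ℝ} {ω : Fin M → ℝ} {ε : ℝ}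

theorem integrable_sum_smul_dirac {α : Type*} [MeasurableSpace α] [MeasurableSingletonClass α]
    (a : Fin M → α) (f : α → ℝ) :
    Integrable f (∑ n, ENNReal.ofReal (ω n) • Measure.dirac (a n)) :=
  integrable_finsetSum_measure.2 fun n _ =>
    (integrable_dirac (by simp)).smul_measure ENNReal.ofReal_ne_top

theorem integral_sum_smul_dirac {α : Type*} [MeasurableSpace α] [MeasurableSingletonClass α]
    (hω : ∀ n, 0 ≤ ω n) (a : Fin M → α) (f : α → ℝ) :
    ∫ v, f v ∂(∑ n, ENNReal.ofReal (ω n) • Measure.dirac (a n)) = ∑ n, ω n * f (a n) := by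
  rw [integral_finsetSum_measure fun n _ =>
    (integrable_dirac (by simp)).smul_measure ENNReal.ofReal_ne_top]
  simp [integral_smul_measure, hω]

theorem isProbabilityMeasure_weightedEmpirical (hω : ∀ n, 0 ≤ ω n) (hsum : ∑ n, ω n = 1) :
    IsProbabilityMeasure (weightedEmpirical ω y) := by
  constructor
  simp [weightedEmpirical, ← ENNReal.ofReal_sum_of_nonneg fun n _ => hω n, hsum]

theorem ae_weightedEmpirical : ∀ᵐ v ∂weightedEmpirical ω y, ∃ n, 0 < ω n ∧ v = y n := by
  have hms : MeasurableSet {v | ∃ n, 0 < ω n ∧ v = y n} := by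
    have : {v | ∃ n, 0 < ω n ∧ v = y n} = y '' {n | 0 < ω n} := by
      ext v; simp [eq_comm]
    rw [this]
    exact (Set.toFinite _).measurableSet
  rw [ae_iff, ← Set.compl_ofPred, weightedEmpirical]
  simp only [Measure.coe_finsetSum, Finset.sum_apply, Measure.smul_apply, smul_eq_mul,
    Measure.dirac_apply' _ hms.compl]
  refine Finset.sum_eq_zero fun n _ => ?_
  by_cases hn : 0 < ω n
  · have : y n ∉ {v | ∃ n, 0 < ω n ∧ v = y n}ᶜ := fun h => h ⟨n, hn, rfl⟩
    simp [Set.indicator_of_notMem this]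
  · simp [ENNReal.ofReal_of_nonpos (not_lt.1 hn)]

/-- A coupling of the reference distribution with a distribution supported on `Ξ`, whose expected
transport cost is finite. -/
structure IsFiniteCoupling (N : Seminorm ℝ (Fin K → ℝ)) (Ξ : Set (Fin K → ℝ))
    (Pref : Measure (Fin K → ℝ)) (π : Measure ((Fin K → ℝ) × (Fin K → ℝ))) : Prop where
  fst : π.fst = Pref
  ae_snd : ∀ᵐ p ∂π, p.2 ∈ Ξ
  integrable : Integrable (fun p => N (p.1 - p.2)) π

/-- The slack `δ` avoids any appeal to an optimal coupling. -/
theorem exists_coupling_of_mem (hΞ : MeasurableSet Ξ) {P Pref : Measure (Fin K → ℝ)} (hε : 0 ≤ ε)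
    (hP : P ∈ wassersteinAmbiguitySet N Ξ Pref ε) {δ : ℝ} (hδ : 0 < δ) :
    ∃ π, IsFiniteCoupling N Ξ Pref π ∧ π.snd = P ∧ ∫ p, N (p.1 - p.2) ∂π ≤ ε + δ := by
  obtain ⟨hP1, hP2, hW⟩ := hP
  have hlt : wassersteinDist N Pref P < ENNReal.ofReal (ε + δ) :=
    hW.trans_lt ((ENNReal.ofReal_lt_ofReal_iff (by linarith)).2 (by linarith))
  simp only [wassersteinDist, iInf_lt_iff] at hlt
  obtain ⟨π, ⟨h1, h2⟩, hlt⟩ := hlt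
  have hmeas : Measurable fun p : (Fin K → ℝ) × (Fin K → ℝ) => N (p.1 - p.2) :=
    (N.continuous_pi_real.comp (by fun_prop)).measurable
  refine ⟨π, ⟨h1, ?_, hmeas.aestronglyMeasurable, ?_⟩, h2, ?_⟩
  · have : ∀ᵐ v ∂P, v ∈ Ξ := by
      rw [← prob_compl_eq_zero_iff hΞ] at hP2
      exact hP2
    rw [← h2] at this
    exact ae_of_ae_map measurable_snd.aemeasurable this
  · rw [hasFiniteIntegral_iff_ofReal (ae_of_all _ fun _ => apply_nonneg N _)]
    exact hlt.trans ENNReal.ofReal_lt_top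
  · rw [integral_eq_lintegral_of_nonneg_ae (ae_of_all _ fun _ => apply_nonneg N _)
      hmeas.aestronglyMeasurable]
    exact ENNReal.toReal_le_of_le_ofReal (by linarith) hlt.le

theorem mem_wassersteinAmbiguitySet_of_coupling (hΞ : MeasurableSet Ξ) {Pref : Measure (Fin K → ℝ)}
    [IsProbabilityMeasure Pref] {π : Measure ((Fin K → ℝ) × (Fin K → ℝ))}
    (h : IsFiniteCoupling N Ξ Pref π) (hle : ∫ p, N (p.1 - p.2) ∂π ≤ ε) :
    π.snd ∈ wassersteinAmbiguitySet N Ξ Pref ε := by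
  have hπ : IsProbabilityMeasure π := by
    constructor
    rw [← Measure.fst_univ, h.fst, measure_univ]
  refine ⟨inferInstance, ?_, ?_⟩
  · rw [Measure.snd_apply hΞ]
    exact (prob_compl_eq_zero_iff (measurable_snd hΞ)).1 h.ae_snd
  · refine (iInf₂_le π ⟨h.fst, rfl⟩).trans ?_
    rw [← ofReal_integral_eq_lintegral_ofReal h.integrable (ae_of_all _ fun _ => apply_nonneg N _)]
    exact ENNReal.ofReal_le_ofReal hle

variable {c : (Fin K → ℝ) → ℝ} {L : ℝ}

/-- Nothing is known of `c` off `Ξ`; continuity on `Ξ` is what makes `c` measurable for measures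
carried by `Ξ`. -/
theorem continuousOn_of_le_add_mul (hL : ∀ u ∈ Ξ, ∀ v ∈ Ξ, c u ≤ c v + L * N (u - v)) :
    ContinuousOn c Ξ := by
  intro v hv
  rw [ContinuousWithinAt, tendsto_iff_dist_tendsto_zero]
  have hlim : Filter.Tendsto (fun u => L * N (u - v)) (nhdsWithin v Ξ) (nhds 0) := by
    have : ContinuousWithinAt (fun u => L * N (u - v)) Ξ v :=
      (continuous_const.mul (N.continuous_pi_real.comp (by fun_prop))).continuousWithinAt
    simpa [ContinuousWithinAt] using this
  refine squeeze_zero' (Filter.Eventually.of_forall fun _ => dist_nonneg) ?_ hlim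
  filter_upwards [self_mem_nhdsWithin] with u hu
  rw [Real.dist_eq, abs_sub_le_iff]
  have h1 := hL u hu v hv
  have h2 := hL v hv u hu
  rw [map_sub_rev] at h2
  constructor <;> linarith

theorem IsFiniteCoupling.aestronglyMeasurable (hΞ : MeasurableSet Ξ)
    (hL : ∀ u ∈ Ξ, ∀ v ∈ Ξ, c u ≤ c v + L * N (u - v)) {Pref : Measure (Fin K → ℝ)}
    {π : Measure ((Fin K → ℝ) × (Fin K → ℝ))} (h : IsFiniteCoupling N Ξ Pref π) :
    AEStronglyMeasurable c π.snd := by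
  have h1 : ∀ᵐ v ∂π.snd, v ∈ Ξ := (ae_map_iff measurable_snd.aemeasurable hΞ).2 h.ae_snd
  have := (continuousOn_of_le_add_mul hL).aestronglyMeasurable (μ := π.snd) hΞ
  rwa [Measure.restrict_eq_self_of_ae_mem h1] at this

theorem IsFiniteCoupling.integrable_snd (hΞ : MeasurableSet Ξ) (hy : ∀ n, y n ∈ Ξ)
    (hω : ∀ n, 0 ≤ ω n) (hsum : ∑ n, ω n = 1)
    (hL : ∀ u ∈ Ξ, ∀ v ∈ Ξ, c u ≤ c v + L * N (u - v))
    {π : Measure ((Fin K → ℝ) × (Fin K → ℝ))}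
    (h : IsFiniteCoupling N Ξ (weightedEmpirical ω y) π) : Integrable c π.snd := by
  have hprob := isProbabilityMeasure_weightedEmpirical (y := y) hω hsum
  have hπ : IsProbabilityMeasure π := by
    constructor
    rw [← Measure.fst_univ, h.fst, measure_univ]
  have hm := h.aestronglyMeasurable hΞ hL
  refine (integrable_map_measure hm measurable_snd.aemeasurable).2 ?_
  -- Almost surely `p.1` is an atom, so `|c p.2|` is at most the sum of the `|c (y n)|` plus `L`
  -- times the transport cost.
  refine Integrable.mono' ((integrable_const (∑ n, |c (y n)|)).add (h.integrable.const_mul L))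
    (hm.comp_measurable measurable_snd) ?_
  have h1 : ∀ᵐ p ∂π, ∃ n, 0 < ω n ∧ p.1 = y n := by
    have := ae_weightedEmpirical (ω := ω) (y := y)
    rw [← h.fst] at this
    exact ae_of_ae_map measurable_fst.aemeasurable this
  filter_upwards [h1, h.ae_snd] with p ⟨n, _, hn⟩ hp
  have h2 : |c (y n)| ≤ ∑ n, |c (y n)| :=
    Finset.single_le_sum (f := fun n => |c (y n)|) (fun _ _ => abs_nonneg _) (Finset.mem_univ n)
  have h3 := hL _ hp _ (hy n)
  have h4 := hL _ (hy n) _ hp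
  rw [map_sub_rev] at h3
  simp only [Function.comp_apply, Pi.add_apply, Real.norm_eq_abs, hn]
  rw [abs_le]
  constructor <;> linarith [abs_le.1 h2, le_abs_self (c (y n)), neg_abs_le (c (y n))]

theorem integrable_of_mem_wassersteinAmbiguitySet (hΞ : MeasurableSet Ξ) (hy : ∀ n, y n ∈ Ξ)
    (hω : ∀ n, 0 ≤ ω n) (hsum : ∑ n, ω n = 1) (hε : 0 ≤ ε)
    (hL : ∀ u ∈ Ξ, ∀ v ∈ Ξ, c u ≤ c v + L * N (u - v)) {P : Measure (Fin K → ℝ)}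
    (hP : P ∈ wassersteinAmbiguitySet N Ξ (weightedEmpirical ω y) ε) : Integrable c P := by
  obtain ⟨π, hπ, rfl, -⟩ := exists_coupling_of_mem hΞ hε hP one_pos
  exact hπ.integrable_snd hΞ hy hω hsum hL

/-- Weak duality for the worst-case expectation over a Wasserstein ball. -/
theorem integral_le_of_mem_wassersteinAmbiguitySet (hΞ : MeasurableSet Ξ) (hy : ∀ n, y n ∈ Ξ)
    (hω : ∀ n, 0 ≤ ω n) (hsum : ∑ n, ω n = 1) (hε : 0 ≤ ε)
    (hL : ∀ u ∈ Ξ, ∀ v ∈ Ξ, c u ≤ c v + L * N (u - v)) {P : Measure (Fin K → ℝ)}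
    (hP : P ∈ wassersteinAmbiguitySet N Ξ (weightedEmpirical ω y) ε) {l : ℝ} (hl : 0 ≤ l)
    {t : Fin M → ℝ} (ht : ∀ n, 0 < ω n → ∀ v ∈ Ξ, c v - l * N (v - y n) ≤ t n) :
    ∫ v, c v ∂P ≤ l * ε + ∑ n, ω n * t n := by
  -- Atoms may coincide while carrying different `t n`; this supremum depends on the point alone and
  -- can be integrated against the marginal.
  let τ : (Fin K → ℝ) → ℝ := fun u => sSup ((fun v => c v - l * N (v - u)) '' Ξ)
  have hτle : ∀ n, ω n * τ (y n) ≤ ω n * t n := by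
    intro n
    rcases (hω n).eq_or_lt with h | h
    · simp [← h]
    · refine mul_le_mul_of_nonneg_left (csSup_le ⟨_, _, hy n, rfl⟩ ?_) h.le
      rintro _ ⟨v, hv, rfl⟩
      exact ht n h v hv
  have hleτ : ∀ n, 0 < ω n → ∀ v ∈ Ξ, c v - l * N (v - y n) ≤ τ (y n) := by
    intro n hn v hv
    refine le_csSup ⟨t n, ?_⟩ ⟨v, hv, rfl⟩
    rintro _ ⟨v, hv, rfl⟩
    exact ht n hn v hv
  suffices H : ∀ δ : ℝ, 0 < δ → ∫ v, c v ∂P ≤ l * (ε + δ) + ∑ n, ω n * t n by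
    refine le_of_forall_pos_le_add fun δ hδ => ?_
    have h1 := H (δ / (l + 1)) (by positivity)
    have h2 : l * (δ / (l + 1)) ≤ δ := by
      rw [mul_div_assoc', div_le_iff₀ (by positivity)]
      nlinarith
    linarith
  intro δ hδ
  obtain ⟨π, hπ, rfl, hcost⟩ := exists_coupling_of_mem hΞ hε hP hδ
  have hint := hπ.integrable_snd hΞ hy hω hsum hL
  have hτint : Integrable τ π.fst := by
    rw [hπ.fst]; exact integrable_sum_smul_dirac y τ
  have e1 : ∫ v, c v ∂π.snd = ∫ p, c p.2 ∂π :=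
    integral_map measurable_snd.aemeasurable hint.aestronglyMeasurable
  have e2 : ∫ p, τ p.1 ∂π = ∑ n, ω n * τ (y n) := by
    rw [← integral_sum_smul_dirac hω y τ]
    change _ = ∫ v, τ v ∂weightedEmpirical ω y
    rw [← hπ.fst]
    exact (integral_map measurable_fst.aemeasurable hτint.aestronglyMeasurable).symm
  have h1 : ∀ᵐ p ∂π, ∃ n, 0 < ω n ∧ p.1 = y n := by
    have := ae_weightedEmpirical (ω := ω) (y := y)
    rw [← hπ.fst] at this
    exact ae_of_ae_map measurable_fst.aemeasurable this
  have hi1 : Integrable (fun p : (Fin K → ℝ) × (Fin K → ℝ) => c p.2) π :=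
    hint.comp_measurable measurable_snd
  have hi2 : Integrable (fun p : (Fin K → ℝ) × (Fin K → ℝ) => τ p.1) π :=
    hτint.comp_measurable measurable_fst
  have hle : ∫ p, c p.2 ∂π ≤ ∫ p, (l * N (p.1 - p.2) + τ p.1) ∂π := by
    refine integral_mono_ae hi1 ((hπ.integrable.const_mul l).add hi2) ?_
    filter_upwards [h1, hπ.ae_snd] with p ⟨n, hn, hpn⟩ hp
    have := hleτ n hn _ hp
    rw [map_sub_rev] at this
    rw [hpn]
    linarith
  rw [integral_add (hπ.integrable.const_mul l) hi2, integral_const_mul, e2] at hle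
  rw [e1]
  have := mul_le_mul_of_nonneg_left hcost hl
  have := Finset.sum_le_sum fun n (_ : n ∈ Finset.univ) => hτle n
  linarith

/-- Mixtures of couplings with a common first marginal are again such couplings, and both integrals
are linear in the coupling. -/
theorem convex_coupling_values (hΞ : MeasurableSet Ξ) (hy : ∀ n, y n ∈ Ξ)
    (hω : ∀ n, 0 ≤ ω n) (hsum : ∑ n, ω n = 1)
    (hL : ∀ u ∈ Ξ, ∀ v ∈ Ξ, c u ≤ c v + L * N (u - v)) :
    Convex ℝ {q : ℝ × ℝ | ∃ π, IsFiniteCoupling N Ξ (weightedEmpirical ω y) π ∧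
      ∫ p, N (p.1 - p.2) ∂π = q.1 ∧ ∫ p, c p.2 ∂π = q.2} := by
  rintro q ⟨π, hπ, h1, h2⟩ q' ⟨π', hπ', h1', h2'⟩ a b ha hb hab
  have hi : Integrable (fun p : (Fin K → ℝ) × (Fin K → ℝ) => c p.2) π :=
    (hπ.integrable_snd hΞ hy hω hsum hL).comp_measurable measurable_snd
  have hi' : Integrable (fun p : (Fin K → ℝ) × (Fin K → ℝ) => c p.2) π' :=
    (hπ'.integrable_snd hΞ hy hω hsum hL).comp_measurable measurable_snd
  refine ⟨ENNReal.ofReal a • π + ENNReal.ofReal b • π', ⟨?_, ?_, ?_⟩, ?_, ?_⟩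
  · rw [Measure.fst_add, Measure.fst, Measure.fst, Measure.map_smul, Measure.map_smul]
    change _ • π.fst + _ • π'.fst = _
    rw [hπ.fst, hπ'.fst, ← add_smul, ← ENNReal.ofReal_add ha hb, hab, ENNReal.ofReal_one, one_smul]
  · rw [ae_add_measure_iff]
    exact ⟨Measure.ae_smul_measure hπ.ae_snd _, Measure.ae_smul_measure hπ'.ae_snd _⟩
  · exact (hπ.integrable.smul_measure ENNReal.ofReal_ne_top).add_measure
      (hπ'.integrable.smul_measure ENNReal.ofReal_ne_top)
  · rw [integral_add_measure (hπ.integrable.smul_measure ENNReal.ofReal_ne_top)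
      (hπ'.integrable.smul_measure ENNReal.ofReal_ne_top), integral_smul_measure,
      integral_smul_measure, h1, h1', ENNReal.toReal_ofReal ha, ENNReal.toReal_ofReal hb]
    simp
  · rw [integral_add_measure (hi.smul_measure ENNReal.ofReal_ne_top)
      (hi'.smul_measure ENNReal.ofReal_ne_top), integral_smul_measure,
      integral_smul_measure, h2, h2', ENNReal.toReal_ofReal ha, ENNReal.toReal_ofReal hb]
    simp

/-- Each atom `y n` is moved whole to `v n`; these couplings are enough to recover the dual
variables. -/
theorem exists_coupling_of_selection (hΞ : MeasurableSet Ξ) (hω : ∀ n, 0 ≤ ω n)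
    {v : Fin M → Fin K → ℝ} (hv : ∀ n, v n ∈ Ξ) :
    ∃ π, IsFiniteCoupling N Ξ (weightedEmpirical ω y) π ∧
      ∫ p, N (p.1 - p.2) ∂π = ∑ n, ω n * N (y n - v n) ∧
      ∫ p, c p.2 ∂π = ∑ n, ω n * c (v n) := by
  refine ⟨∑ n, ENNReal.ofReal (ω n) • Measure.dirac (y n, v n), ⟨?_, ?_, ?_⟩, ?_, ?_⟩
  · ext s hs
    rw [Measure.fst_apply hs]
    simp only [weightedEmpirical, Measure.coe_finsetSum, Finset.sum_apply, Measure.smul_apply,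
      smul_eq_mul, Measure.dirac_apply' _ hs, Measure.dirac_apply' _ (measurable_fst hs)]
    rfl
  · rw [ae_iff, ← Set.compl_ofPred]
    have hm : MeasurableSet {p : (Fin K → ℝ) × (Fin K → ℝ) | p.2 ∈ Ξ} := measurable_snd hΞ
    simp only [Measure.coe_finsetSum, Finset.sum_apply, Measure.smul_apply,
      smul_eq_mul, Measure.dirac_apply' _ hm.compl]
    simp [hv]
  · exact integrable_sum_smul_dirac _ _
  · exact integral_sum_smul_dirac hω _ fun p : (Fin K → ℝ) × (Fin K → ℝ) => N (p.1 - p.2)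
  · exact integral_sum_smul_dirac hω _ fun p : (Fin K → ℝ) × (Fin K → ℝ) => c p.2

/-- Strong duality for the worst-case expectation over a Wasserstein ball centred at a discrete
distribution, with attainment of the dual minimum. -/
theorem exists_worstCase_eq_min (hΞ : MeasurableSet Ξ) (hy : ∀ n, y n ∈ Ξ)
    (hω : ∀ n, 0 ≤ ω n) (hsum : ∑ n, ω n = 1) (hε : 0 ≤ ε) (hL0 : 0 ≤ L)
    (hL : ∀ u ∈ Ξ, ∀ v ∈ Ξ, c u ≤ c v + L * N (u - v)) :
    ∃ F : ℝ, (⨆ P ∈ wassersteinAmbiguitySet N Ξ (weightedEmpirical ω y) ε,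
        ((∫ v, c v ∂P : ℝ) : EReal)) = F ∧
      (∃ (l : ℝ) (t : Fin M → ℝ), 0 ≤ l ∧
        (∀ n, 0 < ω n → ∀ v ∈ Ξ, c v - l * N (v - y n) ≤ t n) ∧ l * ε + ∑ n, ω n * t n ≤ F) ∧
      ∀ (l : ℝ) (t : Fin M → ℝ), 0 ≤ l →
        (∀ n, 0 < ω n → ∀ v ∈ Ξ, c v - l * N (v - y n) ≤ t n) → F ≤ l * ε + ∑ n, ω n * t n := by
  have hprob := isProbabilityMeasure_weightedEmpirical (y := y) hω hsum
  set 𝒰 := wassersteinAmbiguitySet N Ξ (weightedEmpirical ω y) ε with h𝒰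
  set s := ⨆ P ∈ 𝒰, ((∫ v, c v ∂P : ℝ) : EReal) with hs
  have hle : ∀ P ∈ 𝒰, ((∫ v, c v ∂P : ℝ) : EReal) ≤ s := fun P hP =>
    le_iSup₂ (f := fun P (_ : P ∈ 𝒰) => ((∫ v, c v ∂P : ℝ) : EReal)) P hP
  have hub : ∀ (l : ℝ) (t : Fin M → ℝ), 0 ≤ l →
      (∀ n, 0 < ω n → ∀ v ∈ Ξ, c v - l * N (v - y n) ≤ t n) →
      s ≤ ((l * ε + ∑ n, ω n * t n : ℝ) : EReal) := fun l t hl ht =>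
    iSup₂_le fun P hP => EReal.coe_le_coe_iff.2
      (integral_le_of_mem_wassersteinAmbiguitySet hΞ hy hω hsum hε hL hP hl ht)
  obtain ⟨π₀, hπ₀, hπ₀N, hπ₀c⟩ := exists_coupling_of_selection (N := N) (c := c) (y := y) hΞ hω hy
  simp only [sub_self, map_zero, mul_zero, Finset.sum_const_zero] at hπ₀N
  have hmem₀ := mem_wassersteinAmbiguitySet_of_coupling hΞ hπ₀ (hπ₀N.trans_le hε)
  have hLt : ∀ n, 0 < ω n → ∀ v ∈ Ξ, c v - L * N (v - y n) ≤ c (y n) := fun n _ v hv => by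
    linarith [hL v hv _ (hy n)]
  -- Finite above by the dual point `(L, c ∘ y)`, and below by the undisturbed empirical
  -- distribution.
  have hsF : s = (s.toReal : EReal) := by
    refine (EReal.coe_toReal ?_ ?_).symm
    · exact ((hub L _ hL0 hLt).trans_lt (EReal.coe_lt_top _)).ne
    · exact ((EReal.bot_lt_coe _).trans_le (hle _ hmem₀)).ne'
  set F := s.toReal with hF
  refine ⟨F, hsF, ?_, fun l t hl ht => EReal.coe_le_coe_iff.1 (hsF ▸ hub l t hl ht)⟩
  have hint : ∀ π, IsFiniteCoupling N Ξ (weightedEmpirical ω y) π →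
      ∫ v, c v ∂π.snd = ∫ p, c p.2 ∂π := fun π hπ =>
    integral_map measurable_snd.aemeasurable
      (hπ.integrable_snd hΞ hy hω hsum hL).aestronglyMeasurable
  obtain ⟨l, hl, hpen⟩ := exists_penalty_of_convex (convex_coupling_values hΞ hy hω hsum hL)
    (s₀ := ∑ n, ω n * c (y n)) (L := L) (ε := ε) (F := F) ⟨π₀, hπ₀, hπ₀N, hπ₀c⟩ hL0
    (by
      rintro q ⟨π, hπ, h1, h2⟩
      rw [← h1, ← h2, ← hint π hπ, add_comm]
      have hN0 : 0 ≤ ∫ p, N (p.1 - p.2) ∂π := integral_nonneg fun _ => apply_nonneg N _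
      exact integral_le_of_mem_wassersteinAmbiguitySet hΞ hy hω hsum hN0 hL
        (mem_wassersteinAmbiguitySet_of_coupling hΞ hπ le_rfl) hL0 hLt) hε
    (by
      rintro q ⟨π, hπ, h1, h2⟩ hq
      rw [← h2, ← hint π hπ]
      have := hle _ (mem_wassersteinAmbiguitySet_of_coupling hΞ hπ (h1.trans_le hq))
      rw [hsF] at this
      exact EReal.coe_le_coe_iff.1 this)
  have hsel : ∀ v : Fin M → Fin K → ℝ, (∀ n, v n ∈ Ξ) →
      ∑ n, ω n * (c (v n) - l * N (v n - y n)) ≤ F - l * ε := by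
    intro v hv
    obtain ⟨π, hπ, h1, h2⟩ := exists_coupling_of_selection (N := N) (c := c) (y := y) hΞ hω hv
    have := hpen (∑ n, ω n * N (y n - v n), ∑ n, ω n * c (v n)) ⟨π, hπ, h1, h2⟩
    refine le_trans (le_of_eq ?_) this
    rw [Finset.mul_sum, ← Finset.sum_sub_distrib]
    refine Finset.sum_congr rfl fun n _ => ?_
    rw [map_sub_rev]
    ring
  let φ : Fin M → (Fin K → ℝ) → ℝ := fun n v => c v - l * N (v - y n)
  have hbdd : ∀ n, 0 < ω n → BddAbove (φ n '' Ξ) := by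
    intro n hn
    -- Only atom `n` moves, the others stay put and incur no cost.
    refine ⟨(F - l * ε - ∑ m ∈ Finset.univ.erase n, ω m * c (y m)) / ω n, ?_⟩
    rintro _ ⟨v, hv, rfl⟩
    have := hsel (Function.update y n v) (fun m => by
      by_cases hm : m = n
      · subst hm; simpa using hv
      · simpa [hm] using hy m)
    rw [← Finset.add_sum_erase _ _ (Finset.mem_univ n), Function.update_self] at this
    have e : ∑ m ∈ Finset.univ.erase n, ω m * (c (Function.update y n v m) -
        l * N (Function.update y n v m - y m)) = ∑ m ∈ Finset.univ.erase n, ω m * c (y m) :=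
      Finset.sum_congr rfl fun m hm => by
        rw [Function.update_of_ne (Finset.ne_of_mem_erase hm)]; simp
    rw [e] at this
    rw [le_div_iff₀ hn]
    simp only [φ]
    linarith
  refine ⟨l, fun n => sSup (φ n '' Ξ), hl, fun n hn v hv => le_csSup (hbdd n hn) ⟨v, hv, rfl⟩, ?_⟩
  refine le_of_forall_pos_le_add fun δ hδ => ?_
  -- Simultaneous `δ`-maximizers form a selection; the weights sum to one, so the total loss is `δ`.
  have hex : ∀ n, ∃ v ∈ Ξ, ω n * (sSup (φ n '' Ξ) - δ) ≤ ω n * φ n v := by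
    intro n
    obtain ⟨_, ⟨v, hv, rfl⟩, h⟩ := exists_lt_of_lt_csSup (s := φ n '' Ξ) ⟨_, _, hy n, rfl⟩
      (sub_lt_self _ hδ)
    exact ⟨v, hv, mul_le_mul_of_nonneg_left h.le (hω n)⟩
  choose v hv hvle using hex
  have h1 := Finset.sum_le_sum fun n (_ : n ∈ Finset.univ) => hvle n
  have h2 := hsel v hv
  have h3 : ∑ n, ω n * (sSup (φ n '' Ξ) - δ) = ∑ n, ω n * sSup (φ n '' Ξ) - δ := by
    simp only [mul_sub, Finset.sum_sub_distrib, ← Finset.sum_mul, hsum, one_mul]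
  simp only [φ] at h1 h3 ⊢
  linarith

end Wasserstein

/-! ### Assembly of the reformulation. -/

/-- A function that is on `Ξ` a maximum of finitely many affine functions is Lipschitz there. -/
theorem exists_le_add_mul_of_max_affine {K : ℕ} {N : Seminorm ℝ (Fin K → ℝ)}
    (hN : ∀ y : Fin K → ℝ, N y = 0 → y = 0) {Ξ : Set (Fin K → ℝ)} {I : Type*} [Fintype I]
    (d : I → (Fin K → ℝ) × ℝ) {c : (Fin K → ℝ) → ℝ}
    (hc : ∀ y ∈ Ξ, (∀ i, (d i).1 ⬝ᵥ y + (d i).2 ≤ c y) ∧ ∃ i, c y = (d i).1 ⬝ᵥ y + (d i).2) :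
    ∃ L : ℝ, 0 ≤ L ∧ ∀ u ∈ Ξ, ∀ v ∈ Ξ, c u ≤ c v + L * N (u - v) := by
  choose L hL0 hL using fun i => exists_dotProduct_le_mul hN (d i).1
  refine ⟨∑ i, L i, Finset.sum_nonneg fun i _ => hL0 i, fun u hu v hv => ?_⟩
  obtain ⟨i, hi⟩ := (hc u hu).2
  have h1 := (hc v hv).1 i
  have h2 := hL i (u - v)
  have h3 : L i * N (u - v) ≤ (∑ i, L i) * N (u - v) :=
    mul_le_mul_of_nonneg_right
      (Finset.single_le_sum (fun i _ => hL0 i) (Finset.mem_univ i)) (apply_nonneg N _)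
  rw [dotProduct_sub] at h2
  linarith

/-- For a cost that is a maximum of affine functions, the worst-case expectation is finite and is
the minimum of the sections of a representable set. -/
theorem exists_coneRep_worstCaseExpectation {𝒦 : ∀ m : ℕ, Set (Fin m → ℝ) → Prop}
    (hSOC : ∀ m, 𝒦 (m + 1) (secondOrderCone m)) {ι : Type} [Fintype ι] {K M : ℕ}
    {N : Seminorm ℝ (Fin K → ℝ)} (hN : ∀ y : Fin K → ℝ, N y = 0 → y = 0)
    (hdual : 𝒦 (K + 1) (dualNormCone N)) {Xbar X : Set (ι → ℝ)} (hXbar : ConeRep 𝒦 Xbar)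
    (hX : X ⊆ Xbar) {Ξ : Set (Fin K → ℝ)} (hΞ : IsSOCRepresentable Ξ)
    {c : (ι → ℝ) → (Fin K → ℝ) → ℝ} (hc : IsMaxAffineCost 𝒦 X Ξ c) {y : Fin M → Fin K → ℝ}
    (hy : ∀ n, y n ∈ Ξ) {ω : Fin M → ℝ} (hω : ∀ n, 0 ≤ ω n) (hsum : ∑ n, ω n = 1) {ε : ℝ}
    (hε : 0 ≤ ε) :
    ∃ G : Set ((ι → ℝ) × ℝ), ConeRep 𝒦 G ∧ (∀ x τ, (x, τ) ∈ G → x ∈ Xbar) ∧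
      ∀ x ∈ X, ∃ F : ℝ, worstCaseExpectation
        (wassersteinAmbiguitySet N Ξ (weightedEmpirical ω y) ε) c x = F ∧
        IsLeast {τ | (x, τ) ∈ G} F := by
  obtain ⟨I, _, R, hR, hex, hmaj⟩ := hc
  have hne : Ξ.Nonempty := by
    rcases isEmpty_or_nonempty (Fin M) with h | ⟨⟨n⟩⟩
    · simp at hsum
    · exact ⟨_, hy n⟩
  let E := ((ι → ℝ) × ℝ) × (I → (Fin K → ℝ) × ℝ) × ℝ × (Fin M → ℝ)
  let G : Set ((ι → ℝ) × ℝ) := {q | q.1 ∈ Xbar ∧ ∃ w : (I → (Fin K → ℝ) × ℝ) × ℝ × (Fin M → ℝ),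
    (q, w) ∈ {p : E | (p.1.1, p.2.1) ∈ R ∧ 0 ≤ p.2.2.1 ∧
      (∀ n : {n // 0 < ω n}, p ∈ {p : E | ∀ i, p ∈ {p : E |
        ((p.2.1 i).1, p.2.2.1, p.2.2.2 n.1 - (p.2.1 i).2) ∈ {p : (Fin K → ℝ) × ℝ × ℝ |
          0 ≤ p.2.1 ∧ ∀ v ∈ Ξ, p.1 ⬝ᵥ v - p.2.1 * N (v - y n.1) ≤ p.2.2}}}) ∧
      p.2.2.1 * ε + ω ⬝ᵥ p.2.2.2 ≤ p.1.2}}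
  refine ⟨G, ?_, fun x τ h => h.1, fun x hx => ?_⟩
  · refine (hXbar.comap IsAff.id.fst).and (ConeRep.proj ?_)
    have hid : IsAff fun p : E => p := IsAff.id
    refine (hR.comap (hid.fst.fst.prodMk hid.snd.fst)).and
      ((ConeRep.nonneg hSOC hid.snd.snd.fst).and ((ConeRep.forall_mem fun n : {n // 0 < ω n} =>
        ConeRep.forall_mem fun i => (ConeRep.penalized hSOC hN hdual hΞ hne (y n.1)).comap
          ((hid.snd.fst.apply i).fst.prodMk (hid.snd.snd.fst.prodMk
            ((hid.snd.snd.snd.apply n.1).sub (hid.snd.fst.apply i).snd)))).and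
        (ConeRep.le hSOC ((hid.snd.snd.fst.mul_const ε).add
          (hid.snd.snd.snd.const_dotProduct ω)) hid.fst.snd)))
  · obtain ⟨d, hdR, hd⟩ := hex x hx
    obtain ⟨L, hL0, hL⟩ := exists_le_add_mul_of_max_affine hN d hd
    obtain ⟨F, hF, ⟨l, t, hl, ht, hle⟩, hmin⟩ := exists_worstCase_eq_min hΞ.measurableSet hy hω
      hsum hε hL0 hL
    -- The exact pieces `d` together with an optimal dual point attain the value `F`.
    refine ⟨F, hF, ⟨hX hx, (d, l, t), hdR, hl, fun n i => ⟨hl, fun v hv => ?_⟩, hle⟩, ?_⟩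
    · have h1 := ht n.1 n.2 v hv
      have h2 := (hd v hv).1 i
      simp only
      linarith
    · rintro τ ⟨-, ⟨d', l', t'⟩, hdR', hl', hpen, hle'⟩
      refine (hmin l' t' hl' fun n hn v hv => ?_).trans hle'
      -- Members of `R` may overestimate the cost but never underestimate it, so `(l', t')` remains
      -- feasible for the true dual.
      obtain ⟨i, hi⟩ := hmaj x hx d' hdR' v hv
      have h1 := (hpen ⟨n, hn⟩ i).2 v hv
      simp only at h1
      linarith

theorem mainTheorem5 {n₁ n₂ K M : ℕ} {Z Θ : Type*}
    (N : Seminorm ℝ (Fin K → ℝ)) (hN : ∀ y : Fin K → ℝ, N y = 0 → y = 0)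
    (Xbar : Set (Fin n₁ ⊕ Fin n₂ → ℝ)) (hXbar : IsSOCRepresentable Xbar)
    (Ξ : Set (Fin K → ℝ)) (hΞ : IsSOCRepresentable Ξ)
    (c : (Fin n₁ ⊕ Fin n₂ → ℝ) → (Fin K → ℝ) → ℝ)
    (hc : IsSingleStageCost (mixedBinaryRegion Xbar) Ξ c ∨
      IsTwoStageCost (mixedBinaryRegion Xbar) Ξ c)
    (y : Fin M → Fin K → ℝ) (hy : ∀ n, y n ∈ Ξ)
    (ω : Z → Fin M → ℝ) (hω_nonneg : ∀ z n, 0 ≤ ω z n) (hω_sum : ∀ z, ∑ n, ω z n = 1)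
    (ε : Θ → Z → ℝ) (hε : ∀ θ z, 0 ≤ ε θ z) (θ : Θ) (z : Z) :
    (∀ x ∈ mixedBinaryRegion Xbar,
      ∀ P ∈ wassersteinAmbiguitySet N Ξ (weightedEmpirical (ω z) y) (ε θ z),
        MeasureTheory.Integrable (c x) P) ∧
    IsMixedIntegerLinearConeProgram (IsWassersteinCone N) (mixedBinaryRegion Xbar)
      (worstCaseExpectation
        (wassersteinAmbiguitySet N Ξ (weightedEmpirical (ω z) y) (ε θ z)) c) ∧
    ∀ xd : Fin n₁ → ℝ, (∀ i, xd i = 0 ∨ xd i = 1) →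
      IsLinearConeProgram (IsWassersteinCone N)
        {xc : Fin n₂ → ℝ | Sum.elim xd xc ∈ mixedBinaryRegion Xbar}
        (fun xc => worstCaseExpectation
          (wassersteinAmbiguitySet N Ξ (weightedEmpirical (ω z) y) (ε θ z)) c (Sum.elim xd xc)) := by
  have hSOC : ∀ m, IsWassersteinCone N (m + 1) (secondOrderCone m) :=
    IsWassersteinCone.secondOrder
  have hcost : IsMaxAffineCost (IsWassersteinCone N) (mixedBinaryRegion Xbar) Ξ c :=
    hc.elim (fun h => h.isMaxAffineCost hSOC) fun h => h.isMaxAffineCost hSOC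
  obtain ⟨G, hG, hGX, hGf⟩ := exists_coneRep_worstCaseExpectation hSOC hN
    IsWassersteinCone.dualNorm (ConeRep.of_isSOCRepresentable hSOC hXbar)
    (fun x hx => hx.1) hΞ hcost hy (hω_nonneg z) (hω_sum z) (hε θ z)
  refine ⟨fun x hx P hP => ?_, hG.isMixedIntegerLinearConeProgram hGX hGf, fun xd hxd => ?_⟩
  · obtain ⟨I, _, R, -, hex, -⟩ := hcost
    obtain ⟨d, -, hd⟩ := hex x hx
    obtain ⟨L, -, hL⟩ := exists_le_add_mul_of_max_affine hN d hd
    exact integrable_of_mem_wassersteinAmbiguitySet hΞ.measurableSet hy (hω_nonneg z) (hω_sum z)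
      (hε θ z) hL hP
  -- Fixing `x_d` is an affine substitution, under which `G` stays representable.
  · refine (hG.comap (ψ := fun p : (Fin n₂ → ℝ) × ℝ => (Sum.elim xd p.1, p.2))
      (((IsAff.const xd).sumElim IsAff.id.fst).prodMk IsAff.id.snd)).isLinearConeProgram
      (fun xc τ h => ⟨hGX _ _ h, hxd⟩) fun xc hxc => hGf _ hxc
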